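/- **Setting.** Trees are finite unlabeled ordered rooted trees. For $\Delta\ge 0$, $n\ge 1$, let $T_n^\Delta$ be the set of those with $n$ nodes in which every node has at most $\Delta$ children, and let $S^{n,\Delta}=|T_n^\Delta|$. A-order: $T\prec_A T'$ iff $|T|<|T'|$, or $|T|=|T'|$ and for some $i$ the first $i-1$ subtrees of the roots of $T$ and $T'$ coincide and $T_i\prec_A T'_i$. Codeword of a tree: label the root $s$; label an only child $s$; if a node has at least two children, label the leftmost $\ell$, the rightmost $r$ and the others $m$; read the labels in pre-order. A tree $T\in T_n^\Delta$ is stored in global arrays: $C[1..n]$ is its codeword, and $NChild[p]$ ($1\le p\le n$) is the number of left brothers, including itself, of the $p$-th node in pre-order. **Algorithm AOrder-Next($n$)** (it works in place; $\Delta$ is a global variable). 1. $Current:=n$; $STSize:=0$; $RDeleted:=$ false; $finished:=$ false. While $C[Current]=s$ and $Current\ge1$: $STSize$++, $Current$--. If $Current=0$, return "no successor". 2. While not $finished$: $STSize$++; switch on $C[Current]$: - case $r$: $i:=Current-1$; $SNum:=0$; while $C[i]=s$: $SNum$++, $i$--. If $C[i]=r$: updateBrothers$(Current,STSize)$; $Current:=i$;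 $STSize:=SNum$. If $C[i]\in\{m,\ell\}$: if $STSize=1$ then $RDeleted:=$ true; if $STSize>1$ then $STSize$--, $NChild[Current+1]:=NChild[Current]$, updateBrothers$(Current+1,STSize)$; in both cases then $Current:=i$; $STSize:=SNum+1$. - case $m$ (resp. $\ell$): if $RDeleted$ then $C[Current]:=r$ (resp. $s$); updateChildren$(Current+1,STSize-1)$; $finished:=$ true. updateChildren$(i,c)$: while $c>0$: if $c=1$ then $C[i]:=s$, $NChild[i]:=1$, $i$++, $c$--; if $c>1$ then $C[i]:=\ell$, $NChild[i]:=1$, $i$++, $c$--; while $NChild[i-1]<\Delta-1$ and $c>1$ place $m$; then place $r$. Here "place $a$" means $C[i]:=a$, $NChild[i]:=NChild[i-1]+1$, $i$++, $c$--. updateBrothers$(i,c)$: if $c=1$ then $C[i]:=r$. If $c>1$ and $NChild[i]=\Delta$ then $C[i]:=r$, $i$++, $c$--, updateChildren$(i,c)$. If $c>1$ and $NChild[i]\ne\Delta$ then $C[i]:=m$, $i$++, $c$--; while $NChild[i-1]<\Delta-1$ and $c>1$ place $m$; place $r$; updateChildren$(i,c)$. Running time is the number of elementary steps on a random access machine: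 unit cost for each assignment, test, constant, variable or array access, arithmetic, comparison and Boolean operation. Input and output are not counted. **Theorem.** There is an absolute constant $K$ such that: 1. (Correctness and worst case.) For all $\Delta,n$ and $T\in T_n^\Delta$, AOrder-Next started with $T$ stored (all other memory arbitrary) halts after at most $Kn$ steps. If $T$ has a successor $T'$ in the A-order of $T_n^\Delta$, then $T'$ is stored at the end; if $T$ is the last tree of $T_n^\Delta$, the algorithm returns "no successor" and $T$ is still stored. 2. (Average.) For all $\Delta\ge2$ and $n\ge1$, the average over all $S^{n,\Delta}$ codewords of $T_n^\Delta$ trees of the running time of AOrder-Next is at most $K$. 3. For all $\Delta\ge1$ and $n\ge1$, $S^{n+1,\Delta}/S^{n,\Delta}\le K$. -/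

import Mathlib

/-! ### Ordered trees, the classes `T_n^Δ`, and A-order -/

/-- Finite unlabeled ordered (plane) rooted trees: a root with the list of its subtrees. -/
inductive OTree : Type
  | node (children : List OTree) : OTree

namespace OTree

mutual
/-- `|T|`, the number of nodes. -/
def size : OTree → ℕ
  | node ts => forestSize ts + 1
/-- Total number of nodes of a list of trees. -/
def forestSize : List OTree → ℕ
  | [] => 0
  | t :: ts => size t + forestSize ts
end

/-- `T` is a `T^Δ` tree: every node has at most `Δ` children. -/
inductive IsT (Δ : ℕ) : OTree → Prop
  | node (ts : List OTree) (hlen : ts.length ≤ Δ) (hts : ∀ t ∈ ts, IsT Δ t) : IsT Δ (node ts)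

/-- A-order: `T ≺ T'` iff `|T| < |T'|`, or `|T| = |T'|` and at the first index `i` where the
lists of subtrees of the two roots differ, `T_i ≺ T'_i`. (Two trees of equal size cannot have lists
of subtrees one of which is a proper prefix of the other.) -/
inductive ALt : OTree → OTree → Prop
  | of_size {t t' : OTree} (h : t.size < t'.size) : ALt t t'
  | of_child (us : List OTree) (t t' : OTree) (vs vs' : List OTree)
      (hsize : (node (us ++ t :: vs)).size = (node (us ++ t' :: vs')).size)
      (h : ALt t t') : ALt (node (us ++ t :: vs)) (node (us ++ t' :: vs'))

theorem size_pos (t : OTree) : 0 < t.size := by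
  cases t with
  | node ts => simp [size]

theorem size_le_forestSize {t : OTree} {ts : List OTree} (h : t ∈ ts) :
    t.size ≤ forestSize ts := by
  induction ts with
  | nil => simp at h
  | cons a as ih =>
    rcases List.mem_cons.1 h with rfl | h
    · simp [forestSize]
    · have := ih h
      simp only [forestSize]; omega

theorem length_le_forestSize (ts : List OTree) : ts.length ≤ forestSize ts := by
  induction ts with
  | nil => simp
  | cons a as ih =>
    have := size_pos a
    simp only [forestSize, List.length_cons]; omega

theorem finite_size_le (n : ℕ) : {t : OTree | t.size ≤ n}.Finite := by
  induction n with
  | zero =>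
    refine Set.finite_empty.subset ?_
    intro t ht
    have := size_pos t
    simp only [Set.mem_ofPred_eq] at ht
    omega
  | succ n ih =>
    have : Finite {t : OTree | t.size ≤ n} := ih
    have hfin := (List.finite_length_le {t : OTree | t.size ≤ n} n).image
      (fun l => node (l.map Subtype.val))
    refine hfin.subset ?_
    rintro ⟨ts⟩ ht
    simp only [Set.mem_ofPred_eq, size] at ht
    have hmem : ∀ t ∈ ts, t ∈ {t : OTree | t.size ≤ n} := fun t h => by
      have := size_le_forestSize h
      simp only [Set.mem_ofPred_eq]; omega
    refine ⟨ts.attachWith _ hmem, ?_, ?_⟩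
    · have := length_le_forestSize ts
      simp only [Set.mem_ofPred_eq, List.length_attachWith]; omega
    · exact congrArg node (List.attachWith_map_subtype_val hmem)

theorem finite_class (Δ n : ℕ) : {t : OTree | IsT Δ t ∧ t.size = n}.Finite :=
  (finite_size_le n).subset fun _ h => h.2.le

/-- `T_n^Δ`, the class of `T^Δ` trees with `n` nodes; its cardinality is `S^{n,Δ}`. -/
noncomputable def treeClass (Δ n : ℕ) : Finset OTree := (finite_class Δ n).toFinset

/-- `t'` is the immediate successor of `t` in `T_n^Δ` listed in A-order. -/
def IsNext (Δ n : ℕ) (t t' : OTree) : Prop :=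
  t' ∈ treeClass Δ n ∧ ALt t t' ∧ ∀ u ∈ treeClass Δ n, ALt t u → u = t' ∨ ALt t' u

end OTree

/-! ### The 4-letter encoding -/

/-- The alphabet `{s, ℓ, m, r}`. -/
inductive Letter : Type
  | s | l | m | r
  deriving DecidableEq

/-- The label of the `j`-th (`1 ≤ j ≤ k`) of the `k` children of a node. -/
def childLabel (k j : ℕ) : Letter :=
  if k = 1 then Letter.s else if j = 1 then Letter.l else if j = k then Letter.r else Letter.m

namespace OTree

mutual
/-- Pre-order list of pairs (label of the node, number of its left brothers including itself),
when the root is the `j`-th child of its parent and is labeled `a`. -/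
def annotate (a : Letter) (j : ℕ) : OTree → List (Letter × ℕ)
  | node ts => (a, j) :: annotateForest ts.length 1 ts
/-- The same for the children number `j, j + 1, …` of a node that has `k` children in all. -/
def annotateForest (k j : ℕ) : List OTree → List (Letter × ℕ)
  | [] => []
  | t :: ts => annotate (childLabel k j) j t ++ annotateForest k (j + 1) ts
end

/-- The codeword of a tree: the root is labeled `s`, and labels are read in pre-order. -/
def codeword (t : OTree) : List Letter := (annotate Letter.s 1 t).map Prod.fst

/-- For each node in pre-order, the number of its left brothers including itself. -/
def brotherCounts (t : OTree) : List ℕ := (annotate Letter.s 1 t).map Prod.snd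

end OTree

/-! ### A random access machine with two global arrays, and its step count -/

/-- Integer variables. `ci, cnum` are the parameters of `updateChildren`, and `bi, bnum` those of
`updateBrothers`. -/
inductive Reg : Type
  | n | delta | i | current | stSize | sNum | ci | cnum | bi | bnum
  deriving DecidableEq

/-- Boolean variables; `noSuccessor` holds the value returned by the algorithm. -/
inductive BoolVar : Type
  | finished | rDeleted | noSuccessor
  deriving DecidableEq

/-- Memory: the variables and the global arrays `C` and `NChild`. -/
structure Memory : Type where
  reg : Reg → ℕ
  flag : BoolVar → Bool
  C : ℕ → Letter
  NChild : ℕ → ℕ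

/-- Integer expressions (`nchild e` is `NChild[e]`; subtraction is truncated at `0`). -/
inductive Expr : Type
  | lit (k : ℕ)
  | reg (x : Reg)
  | nchild (e : Expr)
  | add (e f : Expr)
  | sub (e f : Expr)

namespace Expr

def eval (σ : Memory) : Expr → ℕ
  | lit k => k
  | reg x => σ.reg x
  | nchild e => σ.NChild (e.eval σ)
  | add e f => e.eval σ + f.eval σ
  | sub e f => e.eval σ - f.eval σ

/-- One step for every constant, variable access, array access and arithmetic operation. -/
def cost : Expr → ℕ
  | lit _ => 1
  | reg _ => 1
  | nchild e => e.cost + 1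
  | add e f => e.cost + f.cost + 1
  | sub e f => e.cost + f.cost + 1

end Expr

/-- Boolean expressions (`letterAt e a` is `C[e] = a`). -/
inductive Test : Type
  | eq (e f : Expr)
  | lt (e f : Expr)
  | letterAt (e : Expr) (a : Letter)
  | flag (x : BoolVar)
  | not (b : Test)
  | and (b c : Test)
  | or (b c : Test)

namespace Test

def eval (σ : Memory) : Test → Bool
  | eq e f => decide (e.eval σ = f.eval σ)
  | lt e f => decide (e.eval σ < f.eval σ)
  | letterAt e a => decide (σ.C (e.eval σ) = a)
  | flag x => σ.flag x
  | not b => !(b.eval σ)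
  | and b c => b.eval σ && c.eval σ
  | or b c => b.eval σ || c.eval σ

/-- One step for every operation, in addition to the evaluation of its arguments. -/
def cost : Test → ℕ
  | eq e f => e.cost + f.cost + 1
  | lt e f => e.cost + f.cost + 1
  | letterAt e _ => e.cost + 1
  | flag _ => 1
  | not b => b.cost + 1
  | and b c => b.cost + c.cost + 1
  | or b c => b.cost + c.cost + 1

end Test

/-- Programs. -/
inductive Cmd : Type
  | skip
  | set (x : Reg) (e : Expr)
  | setFlag (x : BoolVar) (b : Bool)
  | putC (e : Expr) (a : Letter)
  | putNChild (e f : Expr)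
  | seq (c d : Cmd)
  | ite (b : Test) (c d : Cmd)
  | while (b : Test) (c : Cmd)

/-- `Exec c σ k σ'`: started in memory `σ`, the program `c` halts after exactly `k` steps, in
memory `σ'`. Each assignment and each test costs one step in addition to the evaluation of its
expressions. -/
inductive Exec : Cmd → Memory → ℕ → Memory → Prop
  | skip (σ : Memory) : Exec Cmd.skip σ 1 σ
  | set (σ : Memory) (x : Reg) (e : Expr) :
      Exec (Cmd.set x e) σ (e.cost + 1) { σ with reg := Function.update σ.reg x (e.eval σ) }
  | setFlag (σ : Memory) (x : BoolVar) (b : Bool) :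
      Exec (Cmd.setFlag x b) σ 1 { σ with flag := Function.update σ.flag x b }
  | putC (σ : Memory) (e : Expr) (a : Letter) :
      Exec (Cmd.putC e a) σ (e.cost + 1) { σ with C := Function.update σ.C (e.eval σ) a }
  | putNChild (σ : Memory) (e f : Expr) :
      Exec (Cmd.putNChild e f) σ (e.cost + f.cost + 1)
        { σ with NChild := Function.update σ.NChild (e.eval σ) (f.eval σ) }
  | seq {c d : Cmd} {σ σ' σ'' : Memory} {k k' : ℕ} (h : Exec c σ k σ') (h' : Exec d σ' k' σ'') :
      Exec (Cmd.seq c d) σ (k + k') σ''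
  | ite_true {b : Test} {c d : Cmd} {σ σ' : Memory} {k : ℕ} (hb : b.eval σ = true)
      (h : Exec c σ k σ') : Exec (Cmd.ite b c d) σ (b.cost + 1 + k) σ'
  | ite_false {b : Test} {c d : Cmd} {σ σ' : Memory} {k : ℕ} (hb : b.eval σ = false)
      (h : Exec d σ k σ') : Exec (Cmd.ite b c d) σ (b.cost + 1 + k) σ'
  | while_false {b : Test} {c : Cmd} {σ : Memory} (hb : b.eval σ = false) :
      Exec (Cmd.while b c) σ (b.cost + 1) σ
  | while_true {b : Test} {c : Cmd} {σ σ' σ'' : Memory} {k k' : ℕ} (hb : b.eval σ = true)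
      (h : Exec c σ k σ') (h' : Exec (Cmd.while b c) σ' k' σ'') :
      Exec (Cmd.while b c) σ (b.cost + 1 + k + k') σ''

namespace Cmd

/-- `c₁; c₂; …; c_k`. -/
def block : List Cmd → Cmd
  | [] => skip
  | [c] => c
  | c :: d :: cs => seq c (block (d :: cs))

/-- `if b then c`. -/
def when (b : Test) (c : Cmd) : Cmd := ite b c skip

/-- `x++`. -/
def incr (x : Reg) : Cmd := set x (Expr.add (Expr.reg x) (Expr.lit 1))

/-- `x--`. -/
def decr (x : Reg) : Cmd := set x (Expr.sub (Expr.reg x) (Expr.lit 1))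

end Cmd

/-! ### The successor algorithm -/

namespace AOrder

open Cmd

/-- The variable `x` as an expression. -/
abbrev v (x : Reg) : Expr := Expr.reg x

/-- `x - 1` and `x + 1` as expressions. -/
abbrev pred (x : Reg) : Expr := Expr.sub (Expr.reg x) (Expr.lit 1)
abbrev succ (x : Reg) : Expr := Expr.add (Expr.reg x) (Expr.lit 1)

/-- `NChild[x-1] < Δ-1` and `num > 1`. -/
def roomForMiddle (x num : Reg) : Test :=
  Test.and (Test.lt (Expr.nchild (pred x)) (pred Reg.delta)) (Test.lt (Expr.lit 1) (v num))

/-- `C[x] := a; NChild[x] := NChild[x-1] + 1; x++; num--`. -/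
def placeNextBrother (a : Letter) (x num : Reg) : Cmd :=
  block [
    putC (v x) a,
    putNChild (v x) (Expr.add (Expr.nchild (pred x)) (Expr.lit 1)),
    incr x,
    decr num]

/-- Body of `updateChildren(ci, cnum)`. -/
def updateChildrenBody : Cmd :=
  Cmd.while (Test.lt (Expr.lit 0) (v Reg.cnum)) (block [
    when (Test.eq (v Reg.cnum) (Expr.lit 1)) (block [
      putC (v Reg.ci) Letter.s,
      putNChild (v Reg.ci) (Expr.lit 1),
      incr Reg.ci,
      decr Reg.cnum]),
    when (Test.lt (Expr.lit 1) (v Reg.cnum)) (block [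
      putC (v Reg.ci) Letter.l,
      putNChild (v Reg.ci) (Expr.lit 1),
      incr Reg.ci,
      decr Reg.cnum,
      Cmd.while (roomForMiddle Reg.ci Reg.cnum) (placeNextBrother Letter.m Reg.ci Reg.cnum),
      placeNextBrother Letter.r Reg.ci Reg.cnum])])

/-- The call `updateChildren(e, f)`: writes, from position `e` on, the first forest in A-order with
`f` nodes, as the children of one node. -/
def updateChildren (e f : Expr) : Cmd :=
  block [set Reg.ci e, set Reg.cnum f, updateChildrenBody]

/-- Body of `updateBrothers(bi, bnum)`. -/
def updateBrothersBody : Cmd :=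
  ite (Test.eq (v Reg.bnum) (Expr.lit 1))
    (block [putC (v Reg.bi) Letter.r, decr Reg.bnum])
    (when (Test.lt (Expr.lit 1) (v Reg.bnum))
      (ite (Test.eq (Expr.nchild (v Reg.bi)) (v Reg.delta))
        (block [
          putC (v Reg.bi) Letter.r,
          incr Reg.bi,
          decr Reg.bnum,
          updateChildren (v Reg.bi) (v Reg.bnum)])
        (block [
          putC (v Reg.bi) Letter.m,
          decr Reg.bnum,
          incr Reg.bi,
          Cmd.while (roomForMiddle Reg.bi Reg.bnum) (placeNextBrother Letter.m Reg.bi Reg.bnum),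
          placeNextBrother Letter.r Reg.bi Reg.bnum,
          updateChildren (v Reg.bi) (v Reg.bnum)])))

/-- The call `updateBrothers(e, f)`: writes, from position `e` on, the first list of remaining
brothers with `f` nodes in all, the first of which is child number `NChild[e]` of its parent. -/
def updateBrothers (e f : Expr) : Cmd :=
  block [set Reg.bi e, set Reg.bnum f, updateBrothersBody]

/-- The branch `C[Current] = r` of the main loop. -/
def caseR : Cmd :=
  block [
    set Reg.i (pred Reg.current),
    set Reg.sNum (Expr.lit 0),
    Cmd.while (Test.letterAt (v Reg.i) Letter.s) (block [incr Reg.sNum, decr Reg.i]),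
    ite (Test.letterAt (v Reg.i) Letter.r)
      (block [
        updateBrothers (v Reg.current) (v Reg.stSize),
        set Reg.current (v Reg.i),
        set Reg.stSize (v Reg.sNum)])
      (when (Test.or (Test.letterAt (v Reg.i) Letter.m) (Test.letterAt (v Reg.i) Letter.l))
        (block [
          ite (Test.eq (v Reg.stSize) (Expr.lit 1))
            (setFlag BoolVar.rDeleted true)
            (when (Test.lt (Expr.lit 1) (v Reg.stSize)) (block [
              decr Reg.stSize,
              putNChild (succ Reg.current) (Expr.nchild (v Reg.current)),
              updateBrothers (succ Reg.current) (v Reg.stSize)])),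
          set Reg.current (v Reg.i),
          set Reg.stSize (succ Reg.sNum)]))]

/-- The branches `C[Current] = m` (`a = r`) and `C[Current] = ℓ` (`a = s`) of the main loop: if the
right brother has been deleted, the node is relabeled `a`; then its subtree is rebuilt. -/
def caseLeftBrother (a : Letter) : Cmd :=
  block [
    when (Test.flag BoolVar.rDeleted) (putC (v Reg.current) a),
    updateChildren (succ Reg.current) (pred Reg.stSize),
    setFlag BoolVar.finished true]

/-- The main loop, `while not finished do …`. -/
def mainLoop : Cmd :=
  Cmd.while (Test.not (Test.flag BoolVar.finished)) (block [
    incr Reg.stSize,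
    ite (Test.letterAt (v Reg.current) Letter.r) caseR
      (ite (Test.letterAt (v Reg.current) Letter.m) (caseLeftBrother Letter.r)
        (when (Test.letterAt (v Reg.current) Letter.l) (caseLeftBrother Letter.s)))])

/-- The algorithm AOrder-Next. -/
def next : Cmd :=
  block [
    setFlag BoolVar.noSuccessor false,
    set Reg.current (v Reg.n),
    set Reg.stSize (Expr.lit 0),
    setFlag BoolVar.rDeleted false,
    setFlag BoolVar.finished false,
    Cmd.while (Test.and (Test.letterAt (v Reg.current) Letter.s)
        (Test.lt (Expr.lit 0) (v Reg.current)))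
      (block [incr Reg.stSize, decr Reg.current]),
    ite (Test.eq (v Reg.current) (Expr.lit 0))
      (setFlag BoolVar.noSuccessor true)
      mainLoop]

/-- The memory `σ` holds the tree `t` with `n` nodes, with degree bound `Δ`: the codeword of `t` is
in `C[1..n]`, and `NChild[1..n]` holds for each node the number of its left brothers including
itself. All other variables and memory cells are arbitrary. -/
def Holds (Δ n : ℕ) (t : OTree) (σ : Memory) : Prop :=
  σ.reg Reg.n = n ∧ σ.reg Reg.delta = Δ ∧
    (List.range n).map (fun p => σ.C (p + 1)) = t.codeword ∧
    (List.range n).map (fun p => σ.NChild (p + 1)) = t.brotherCounts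

end AOrder

-- A-order: the last tree of a given size and the first forests

namespace OTree

-- Successor. Among the trees of one size the path (`chain`) comes last in A-order, and the first
-- forest with `c` nodes and at most `d` trees (`first`) uses leaves as long as it can and hangs
-- everything left over below its last root. So a tree that is not a chain is advanced at the
-- rightmost place where a change is possible. If the last subtree is not a chain, it is advanced.
-- If it is a chain but its left brother is not, the brother is advanced and the nodes of the chain
-- are rearranged into the first forest. If both are chains, the brother becomes the first tree with
-- one more node, and one node fewer remains to its right. `Step` consists of these three rules;
-- `eq_chain_or_step` shows that they cover every tree but the chains, and `Step.isNext` that they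
-- skip nothing.
--
-- Program. The annotated codeword of a tree that is not a chain ends with `r` followed by letters
-- `s` only, and the letter before these tells which rule applies. `WP_mainLoop` follows a
-- derivation of `Step`: the first rule only changes the point of view, the second is one iteration,
-- the third two. The part rewritten begins at the last node with a right brother, and the number of
-- later nodes is `work t`. This yields at most `500 * work t + 60` steps (`exec_next_le`); since
-- `work t` is less than the size, the worst case is linear.
--
-- Ratio. Deleting a marked leaf or contracting a marked node with one child loses little
-- information, and in every tree twice the number of leaves plus the number of nodes with one child
-- exceeds the size. Double counting gives `S^{n+1} ≤ 5 S^n` (`card_treeClass_succ_le`).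
--
-- Average. If the last node is an only child, its removal lowers `work` by one. If it has a left
-- brother `w`, then `work t = work w + 1`, and with the rest of the tree fixed `w` ranges over a
-- whole class of smaller trees, so an induction on the size applies (`sum_work_lastBrother_le`).
-- When `w` is a leaf its work is `0`. Trees in which a leaf is the only left brother of the last
-- node form, by the ratio bound, a fixed proportion of the class; what the induction saves on them
-- pays for all the increments by one (`card_add_card_le`, `sum_work_le`).

theorem forestSize_append (us vs : List OTree) :
    forestSize (us ++ vs) = forestSize us + forestSize vs := by
  induction us with
  | nil => simp [forestSize]
  | cons a as ih => simp only [List.cons_append, forestSize, ih]; omega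

theorem isT_node {Δ : ℕ} {ts : List OTree} :
    IsT Δ (node ts) ↔ ts.length ≤ Δ ∧ ∀ t ∈ ts, IsT Δ t :=
  ⟨fun h => by cases h with | node _ h₁ h₂ => exact ⟨h₁, h₂⟩, fun h => .node _ h.1 h.2⟩

theorem mem_treeClass {Δ n : ℕ} {t : OTree} : t ∈ treeClass Δ n ↔ IsT Δ t ∧ t.size = n := by
  simp [treeClass]

theorem forestSize_eq_zero {ts : List OTree} : forestSize ts = 0 ↔ ts = [] := by
  cases ts with
  | nil => simp [forestSize]
  | cons a as => have := size_pos a; simp [forestSize]; omega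

theorem size_eq_one {t : OTree} : t.size = 1 ↔ t = node [] := by
  cases t with
  | node ts => simp [size, forestSize_eq_zero]

/-- Lexicographic comparison of lists of trees by `ALt`, at the first difference. -/
inductive FLt : List OTree → List OTree → Prop
  | head {t t' : OTree} (vs vs' : List OTree) (h : ALt t t') : FLt (t :: vs) (t' :: vs')
  | tail (t : OTree) {vs vs' : List OTree} (h : FLt vs vs') : FLt (t :: vs) (t :: vs')

theorem FLt.exists_split {ts ts' : List OTree} (h : FLt ts ts') :
    ∃ us t t' vs vs', ts = us ++ t :: vs ∧ ts' = us ++ t' :: vs' ∧ ALt t t' := by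
  induction h with
  | @head t t' vs vs' h => exact ⟨[], t, t', vs, vs', rfl, rfl, h⟩
  | tail a _ ih =>
    obtain ⟨us, t, t', vs, vs', rfl, rfl, h⟩ := ih
    exact ⟨a :: us, t, t', vs, vs', rfl, rfl, h⟩

theorem FLt.append_left {vs vs' : List OTree} (us : List OTree) (h : FLt vs vs') :
    FLt (us ++ vs) (us ++ vs') := by
  induction us with
  | nil => exact h
  | cons a _ ih => exact .tail a ih

/-- The form of the order used in all later arguments: the search for a first differing index is
replaced by `FLt`, on which one can induct along the lists. -/
theorem ALt_node {ts ts' : List OTree} : ALt (node ts) (node ts') ↔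
    forestSize ts < forestSize ts' ∨ (forestSize ts = forestSize ts' ∧ FLt ts ts') := by
  constructor
  · intro h
    generalize ha : node ts = a at h
    generalize hb : node ts' = b at h
    cases h with
    | of_size h => subst ha hb; simp only [size] at h; left; omega
    | of_child us t t' vs vs' hs h =>
      obtain rfl : ts = us ++ t :: vs := by injection ha
      obtain rfl : ts' = us ++ t' :: vs' := by injection hb
      simp only [size] at hs
      exact .inr ⟨by omega, (FLt.head vs vs' h).append_left us⟩
  · rintro (h | ⟨hs, h⟩)
    · exact .of_size (by simp only [size]; omega)
    · obtain ⟨us, t, t', vs, vs', rfl, rfl, hlt⟩ := h.exists_split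
      exact .of_child us t t' vs vs' (by simp only [size]; omega) hlt

theorem ALt.size_le {t t' : OTree} (h : ALt t t') : t.size ≤ t'.size := by
  cases h with
  | of_size h => exact h.le
  | of_child _ _ _ _ _ hs _ => exact hs.le

/-- Asymmetry of `ALt` is assumed only below members of `ts`, which is what a strong induction on
the size can supply. -/
theorem FLt.asymm {ts ts' : List OTree} (h : FLt ts ts')
    (H : ∀ t ∈ ts, ∀ t', ALt t t' → ¬ ALt t' t) : ¬ FLt ts' ts := by
  induction h with
  | @head t t' vs vs' h =>
    intro h'
    cases h' with
    | head _ _ h' => exact H t (by simp) _ h h'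
    | tail _ _ => exact H t (by simp) _ h h
  | tail t h ih =>
    intro h'
    cases h' with
    | head _ _ h' => exact H t (by simp) _ h' h'
    | tail _ h' => exact ih (fun t ht => H t (by simp [ht])) h'

theorem ALt.asymm {t t' : OTree} (h : ALt t t') : ¬ ALt t' t := by
  induction hn : t.size using Nat.strong_induction_on generalizing t t' with
  | _ n ih =>
    subst hn
    obtain ⟨ts⟩ := t
    obtain ⟨ts'⟩ := t'
    rw [ALt_node] at h ⊢
    rintro (h' | ⟨_, h'⟩)
    · omega
    · rcases h with h | ⟨_, h⟩
      · omega
      · refine h.asymm (fun t ht t' h => ih _ ?_ h rfl) h'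
        have := size_le_forestSize ht
        simp only [size]; omega

/-- The tree with `k + 1` nodes in which no node has two children. -/
def chain : ℕ → OTree
  | 0 => node []
  | k + 1 => node [chain k]

@[simp] theorem size_chain (k : ℕ) : (chain k).size = k + 1 := by
  induction k with
  | zero => simp [chain, size, forestSize]
  | succ k ih => simp [chain, size, forestSize, ih]

theorem isT_chain {Δ : ℕ} (hΔ : 1 ≤ Δ) (k : ℕ) : IsT Δ (chain k) := by
  induction k with
  | zero => simp [chain, isT_node]
  | succ k ih => simp [chain, isT_node, ih, hΔ]

/-- The single subtree of the root of a chain holds all other nodes. A tree of no larger size could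
be later only through its first subtree, which again meets a chain at least as large as itself. -/
theorem not_ALt_chain {k : ℕ} {u : OTree} (hu : u.size ≤ k + 1) : ¬ ALt (chain k) u := by
  induction k generalizing u with
  | zero =>
    obtain rfl := size_eq_one.1 (le_antisymm hu (size_pos u))
    exact fun h => h.asymm h
  | succ k ih =>
    obtain ⟨us⟩ := u
    simp only [size] at hu
    rw [chain, ALt_node]
    simp only [forestSize, size_chain]
    rintro (h | ⟨hs, h⟩)
    · omega
    · cases h with
      | head _ _ h =>
        simp only [forestSize] at hs
        exact ih (by omega) h
      | tail _ h => cases h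

/-- The first forest in A-order with `c` nodes and at most `d` trees, all in `T^Δ`. -/
def first (Δ : ℕ) : ℕ → ℕ → List OTree
  | _, 0 => []
  | d, c + 1 => if d ≤ 1 ∨ c = 0 then [node (first Δ Δ c)] else node [] :: first Δ (d - 1) c

theorem forestSize_first (Δ d c : ℕ) : forestSize (first Δ d c) = c := by
  induction c generalizing d with
  | zero => simp [first, forestSize]
  | succ c ih =>
    rw [first]
    split_ifs
    · simp [forestSize, size, ih]
    · simp [forestSize, size, ih]; omega

theorem length_first_ne_zero {Δ d c : ℕ} (hc : c ≠ 0) : (first Δ d c).length ≠ 0 := fun h => by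
  have := forestSize_first Δ d c
  rw [List.length_eq_zero_iff.1 h] at this
  exact hc this.symm

theorem length_first_le {Δ d c : ℕ} (hd : 1 ≤ d) : (first Δ d c).length ≤ d := by
  induction c generalizing d with
  | zero => simp [first]
  | succ c ih =>
    rw [first]
    split_ifs with h
    · simpa
    · have := @ih (d - 1) (by omega)
      simp only [List.length_cons]; omega

theorem isT_first {Δ d c : ℕ} (hΔ : 1 ≤ Δ) : ∀ t ∈ first Δ d c, IsT Δ t := by
  induction c generalizing d with
  | zero => simp [first]
  | succ c ih =>
    rw [first]
    split_ifs with h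
    · simpa [isT_node] using ⟨length_first_le hΔ, ih⟩
    · simpa [isT_node] using ih

/-- The earliest possible first tree is a leaf, and a leaf is allowed unless a single tree has to
take all nodes. In that case the same problem recurs below its root, with `Δ` slots. -/
theorem first_minimal {Δ d : ℕ} {vs : List OTree} (hvs : ∀ t ∈ vs, IsT Δ t)
    (hlen : vs.length ≤ d) :
    vs = first Δ d (forestSize vs) ∨ FLt (first Δ d (forestSize vs)) vs := by
  induction hc : forestSize vs generalizing d vs with
  | zero => simp [first, forestSize_eq_zero.1 hc]
  | succ c ih =>
    cases vs with
    | nil => simp [forestSize] at hc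
    | cons v vs =>
      simp only [forestSize] at hc
      simp only [List.length_cons] at hlen
      rw [first]
      split_ifs with h
      · have hv : vs = [] := by
          rcases h with h | h
          · exact List.length_eq_zero_iff.1 (by omega)
          · have := size_pos v
            exact forestSize_eq_zero.1 (by omega)
        subst hv
        obtain ⟨ws⟩ := v
        simp only [forestSize, size] at hc
        obtain ⟨h₁, h₂⟩ := isT_node.1 (hvs (node ws) (by simp))
        rcases ih h₂ h₁ (by omega) with h | h
        · left; rw [← h]
        · right
          exact .head _ _ (ALt_node.2 (.inr ⟨by rw [forestSize_first]; omega, h⟩))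
      · by_cases hv : v.size = 1
        · obtain rfl := size_eq_one.1 hv
          have hc' : forestSize vs = c := by omega
          rcases ih (d := d - 1) (fun t ht => hvs t (by simp [ht])) (by omega) hc'
            with h | h
          · left; rw [← h]
          · right; exact .tail _ h
        -- Here `first` begins with a leaf and `vs` does not, so the sizes of the first trees
        -- decide.
        · right
          have := size_pos v
          exact .head _ _ (.of_size (by simp only [size, forestSize]; omega))

-- The successor rule and its correctness

/-- `Step Δ t t'`: the rule that computes the successor `t'` of `t` in A-order. -/
inductive Step (Δ : ℕ) : OTree → OTree → Prop
  | inner (us : List OTree) {y y' : OTree} (h : Step Δ y y') :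
      Step Δ (node (us ++ [y])) (node (us ++ [y']))
  | left (us : List OTree) (b : ℕ) {x x' : OTree} (h : Step Δ x x') :
      Step Δ (node (us ++ [x, chain b]))
        (node (us ++ x' :: first Δ (Δ - us.length - 1) (b + 1)))
  | grow (us : List OTree) (a b : ℕ) :
      Step Δ (node (us ++ [chain a, chain b]))
        (node (us ++ node (first Δ Δ (a + 1)) :: first Δ (Δ - us.length - 1) b))

/-- If the last subtree is a chain without left brother, the whole tree is a chain. Otherwise the
last subtree, or its left brother when the last subtree is a chain, selects the rule. -/
theorem eq_chain_or_step {Δ : ℕ} (t : OTree) : (∃ k, t = chain k) ∨ ∃ t', Step Δ t t' := by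
  induction hn : t.size using Nat.strong_induction_on generalizing t with
  | _ n ih =>
    subst hn
    obtain ⟨ts⟩ := t
    rcases ts.eq_nil_or_concat with rfl | ⟨us, y, rfl⟩
    · exact .inl ⟨0, rfl⟩
    · simp only [size, List.concat_eq_append, forestSize_append, forestSize] at ih ⊢
      rcases ih y.size (by omega) y rfl with ⟨b, rfl⟩ | ⟨y', h⟩
      · rcases us.eq_nil_or_concat with rfl | ⟨us, x, rfl⟩
        · exact .inl ⟨b + 1, rfl⟩
        · right
          simp only [List.concat_eq_append, forestSize_append, forestSize, List.append_assoc,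
            List.cons_append, List.nil_append] at ih ⊢
          rcases ih x.size (by omega) x rfl with ⟨a, rfl⟩ | ⟨x', h⟩
          · exact ⟨_, .grow us a b⟩
          · exact ⟨_, .left us b h⟩
      · exact .inr ⟨_, .inner us h⟩

theorem Step.size_eq {Δ : ℕ} {t t' : OTree} (h : Step Δ t t') : t'.size = t.size := by
  induction h with
  | inner us h ih => simp [size, forestSize_append, forestSize, ih]
  | left us b h ih => simp [size, forestSize_append, forestSize, ih, forestSize_first]
  | grow us a b => simp [size, forestSize_append, forestSize, forestSize_first]; omega

theorem Step.isT {Δ : ℕ} {t t' : OTree} (h : Step Δ t t') (ht : IsT Δ t) : IsT Δ t' := by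
  induction h with
  | inner us h ih =>
    simp only [isT_node, List.mem_append, List.mem_singleton, List.length_append,
      List.length_singleton] at ht ⊢
    refine ⟨ht.1, ?_⟩
    rintro t (h | rfl)
    · exact ht.2 t (.inl h)
    · exact ih (ht.2 _ (.inr rfl))
  | left us b h ih =>
    simp only [isT_node, List.mem_append, List.mem_cons, List.length_append,
      List.length_cons, List.length_nil] at ht ⊢
    have := @length_first_le Δ (Δ - us.length - 1) (b + 1) (by omega)
    refine ⟨by omega, ?_⟩
    rintro t (h | rfl | h)
    · exact ht.2 t (.inl h)
    · exact ih (ht.2 _ (.inr (.inl rfl)))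
    · exact isT_first (by omega) t h
  | grow us a b =>
    simp only [isT_node, List.mem_append, List.mem_cons, List.length_append,
      List.length_cons, List.length_nil] at ht ⊢
    have := @length_first_le Δ (Δ - us.length - 1) b (by omega)
    refine ⟨by omega, ?_⟩
    rintro t (h | rfl | h)
    · exact ht.2 t (.inl h)
    · exact isT_node.2 ⟨length_first_le (by omega), isT_first (by omega)⟩
    · exact isT_first (by omega) t h

theorem Step.lt {Δ : ℕ} {t t' : OTree} (h : Step Δ t t') : ALt t t' := by
  induction h with
  | inner us h ih =>
    refine ALt_node.2 (.inr ⟨?_, (FLt.head _ _ ih).append_left us⟩)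
    simp [forestSize_append, forestSize, h.size_eq]
  | left us b h ih =>
    refine ALt_node.2 (.inr ⟨?_, (FLt.head _ _ ih).append_left us⟩)
    simp [forestSize_append, forestSize, h.size_eq, forestSize_first]
  | grow us a b =>
    refine ALt_node.2 (.inr ⟨?_, (FLt.head _ _ (.of_size ?_)).append_left us⟩)
    · simp [forestSize_append, forestSize, size, forestSize_first]; omega
    · simp [size, forestSize_first]

/-- `zs` is the first forest after `ys` among the forests of as many nodes with at most `d`
trees. -/
def IsNextForest (Δ d : ℕ) (ys zs : List OTree) : Prop :=
  ∀ vs : List OTree, vs.length ≤ d → forestSize vs = forestSize ys → (∀ t ∈ vs, IsT Δ t) →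
    FLt ys vs → vs = zs ∨ FLt zs vs

/-- A forest that departs from `us ++ ys` inside `us` is later than `us ++ zs` for the same reason.
Otherwise the common prefix has used `us.length` of the `d` slots. -/
theorem IsNextForest.append_left {Δ d : ℕ} {ys zs : List OTree} (us : List OTree)
    (h : IsNextForest Δ (d - us.length) ys zs) : IsNextForest Δ d (us ++ ys) (us ++ zs) := by
  induction us generalizing d with
  | nil => exact h
  | cons a us ih =>
    intro vs hlen hs hT hlt
    simp only [List.cons_append] at hlt ⊢
    cases hlt with
    | head _ _ hlt => exact .inr (.head _ _ hlt)
    | @tail _ _ vs hlt =>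
      simp only [List.length_cons] at hlen
      simp only [List.cons_append, forestSize] at hs
      rcases ih (d := d - 1) (by convert h using 1; simp only [List.length_cons]; omega) vs
        (by omega) (by omega)
        (fun t ht => hT t (by simp [ht])) hlt with h | h
      · exact .inl (by rw [h])
      · exact .inr (.tail _ h)

theorem isNext_node {Δ : ℕ} {ys zs us : List OTree}
    (h : IsNextForest Δ (Δ - us.length) ys zs) (hs : forestSize zs = forestSize ys) {u : OTree}
    (hu : IsT Δ u) (hus : u.size = (node (us ++ ys)).size) (hlt : ALt (node (us ++ ys)) u) :
    u = node (us ++ zs) ∨ ALt (node (us ++ zs)) u := by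
  obtain ⟨vs⟩ := u
  obtain ⟨h₁, h₂⟩ := isT_node.1 hu
  simp only [size] at hus
  rcases ALt_node.1 hlt with hlt | ⟨-, hlt⟩
  · omega
  · rcases h.append_left us vs h₁ (by omega) h₂ hlt with h | h
    · exact .inl (by rw [h])
    · refine .inr (ALt_node.2 (.inr ⟨?_, h⟩))
      simp only [forestSize_append] at hus ⊢
      omega

/-- A later tree must differ inside the part rewritten by the rule, because a final chain is already
the last tree of its size. Within that part the rule takes the least admissible change, followed by
the first forest. -/
theorem Step.isNext {Δ : ℕ} {t t' : OTree} (h : Step Δ t t') (ht : IsT Δ t) {u : OTree}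
    (hu : IsT Δ u) (hus : u.size = t.size) (hlt : ALt t u) : u = t' ∨ ALt t' u := by
  induction h generalizing u with
  | @inner us y y' h ih =>
    refine isNext_node ?_ ?_ hu hus hlt
    · intro vs hlen hs hT hlt
      cases hlt with
      | @head _ y₂ _ vs hlt =>
        simp only [forestSize] at hs
        have := hlt.size_le
        obtain rfl : vs = [] := forestSize_eq_zero.1 (by omega)
        rcases ih ((isT_node.1 ht).2 _ (by simp)) (hT y₂ (by simp))
          (by simp [forestSize] at hs; omega) hlt
          with rfl | h
        · exact .inl rfl
        · exact .inr (.head _ _ h)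
      | tail _ h => cases h
    · simp [forestSize, h.size_eq]
  | @left us b x x' h ih =>
    refine isNext_node ?_ ?_ hu hus hlt
    · intro vs hlen hs hT hlt
      cases hlt with
      | @head _ x₂ _ vs hlt =>
        simp only [forestSize, size_chain] at hs
        have := hlt.size_le
        have hx := h.size_eq
        -- With equal sizes the induction decides between `x₂` and `x'`; a tree `x₂` with more nodes
        -- is later than `x'` at once.
        by_cases hsz : x₂.size = x.size
        · rcases ih ((isT_node.1 ht).2 _ (by simp)) (hT x₂ (by simp)) hsz hlt with rfl | h
          · have := @first_minimal Δ (Δ - us.length - 1) vs (fun t ht => hT t (by simp [ht]))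
              (by simp at hlen; omega)
            rw [show forestSize vs = b + 1 by omega] at this
            rcases this with h | h
            · exact .inl (by rw [← h])
            · exact .inr (.tail _ h)
          · exact .inr (.head _ _ h)
        · exact .inr (.head _ _ (.of_size (by omega)))
      -- With `x` kept, the final chain would have to be followed by a later tree with no more
      -- nodes.
      | @tail _ _ vs hlt =>
        cases hlt with
        | head _ _ hlt =>
          simp only [forestSize, size_chain] at hs
          exact absurd hlt (not_ALt_chain (by omega))
        | tail _ h => cases h
    · simp [forestSize, h.size_eq, forestSize_first]
  | grow us a b =>
    refine isNext_node ?_ ?_ hu hus hlt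
    · intro vs hlen hs hT hlt
      cases hlt with
      | @head _ x₂ _ vs hlt =>
        simp only [forestSize, size_chain] at hs
        -- `chain a` is the last tree of its size, so the left brother can advance only by gaining a
        -- node; `a + 2` is the least size possible.
        have hlt' : a + 1 < x₂.size := by
          by_contra hle
          exact not_ALt_chain (by omega) hlt
        by_cases hsz : x₂.size = a + 2
        · obtain ⟨ws⟩ := x₂
          simp only [size] at hsz
          obtain ⟨h₁, h₂⟩ := isT_node.1 (hT (node ws) (by simp))
          have hw := first_minimal h₂ h₁
          rw [show forestSize ws = a + 1 by omega] at hw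
          have hv := @first_minimal Δ (Δ - us.length - 1) vs (fun t ht => hT t (by simp [ht]))
            (by simp at hlen; omega)
          rw [show forestSize vs = b by simp only [size] at hs; omega] at hv
          rcases hw with rfl | hw
          · rcases hv with h | h
            · exact .inl (by rw [← h])
            · exact .inr (.tail _ h)
          · exact .inr (.head _ _ (ALt_node.2 (.inr ⟨by rw [forestSize_first]; omega, hw⟩)))
        · exact .inr (.head _ _ (.of_size (by simp only [size, forestSize_first]; omega)))
      | @tail _ _ vs hlt =>
        cases hlt with
        | head _ _ hlt =>
          simp only [forestSize, size_chain] at hs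
          exact absurd hlt (not_ALt_chain (by omega))
        | tail _ h => cases h
    · simp [forestSize, size, forestSize_first]; omega

theorem Step.eq_of_isNext {Δ n : ℕ} {t t' t'' : OTree} (h : Step Δ t t') (ht : t ∈ treeClass Δ n)
    (h' : IsNext Δ n t t'') : t'' = t' := by
  rw [mem_treeClass] at ht
  obtain ⟨h₁, h₂, h₃⟩ := h'
  rw [mem_treeClass] at h₁
  rcases h.isNext ht.1 h₁.1 (by omega) h₂ with rfl | h₄
  · rfl
  · rcases h₃ t' (mem_treeClass.2 ⟨h.isT ht.1, by rw [h.size_eq, ht.2]⟩) h.lt with rfl | h₅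
    · rfl
    · exact absurd h₅ h₄.asymm

-- Codewords and their final letters `s` and `r`

/-- The annotated codeword of a tree without its root. -/
def inside : OTree → List (Letter × ℕ)
  | node ts => annotateForest ts.length 1 ts

theorem annotate_eq (a : Letter) (j : ℕ) (t : OTree) : annotate a j t = (a, j) :: inside t := by
  cases t; simp [annotate, inside]

theorem annotateForest_append (k j : ℕ) (us vs : List OTree) :
    annotateForest k j (us ++ vs) =
      annotateForest k j us ++ annotateForest k (j + us.length) vs := by
  induction us generalizing j with
  | nil => simp [annotateForest]
  | cons a us ih => simp [annotateForest, ih, Nat.add_assoc, Nat.add_comm 1]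

theorem annotateForest_cons (k j : ℕ) (t : OTree) (ts : List OTree) :
    annotateForest k j (t :: ts) =
      (childLabel k j, j) :: (inside t ++ annotateForest k (j + 1) ts) := by
  simp [annotateForest, annotate_eq]

theorem length_inside_add_one (t : OTree) : (inside t).length + 1 = t.size := by
  induction hn : t.size using Nat.strong_induction_on generalizing t with
  | _ n ih =>
    obtain ⟨ts⟩ := t
    subst hn
    have H : ∀ us : List OTree, (∀ u ∈ us, u ∈ ts) → ∀ k j,
        (annotateForest k j us).length = forestSize us := by
      intro us
      induction us with
      | nil => simp [annotateForest, forestSize]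
      | cons u us ihu =>
        intro hus k j
        have h₁ := size_le_forestSize (hus u (by simp))
        have h₂ := ih u.size (by simp only [size]; omega) u rfl
        have h₃ := ihu (fun v hv => hus v (by simp [hv])) k (j + 1)
        simp only [annotateForest_cons, List.length_cons, List.length_append, forestSize]
        omega
    simp only [inside, size, H ts (fun _ h => h)]

theorem length_annotate (a : Letter) (j : ℕ) (t : OTree) : (annotate a j t).length = t.size := by
  simp [annotate_eq, length_inside_add_one]

theorem length_annotateForest (k j : ℕ) (ts : List OTree) :
    (annotateForest k j ts).length = forestSize ts := by
  induction ts generalizing j with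
  | nil => simp [annotateForest, forestSize]
  | cons t ts ih => simp [annotateForest, forestSize, ih, length_annotate]

theorem inside_chain (b : ℕ) : inside (chain b) = List.replicate b (Letter.s, 1) := by
  induction b with
  | zero => simp [chain, inside, annotateForest]
  | succ b ih =>
    change annotateForest 1 1 [chain b] = _
    simp [annotateForest, annotate_eq, childLabel, ih, List.replicate_succ]

/-- The letter of a node that has no right brother. -/
def isLast (a : Letter) : Bool := a = Letter.s ∨ a = Letter.r

/-- The length of the longest suffix of a word that consists of letters `s` and `r`. -/
def run (W : List (Letter × ℕ)) : ℕ := (W.reverse.takeWhile fun x => isLast x.1).length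

theorem run_append_of_all {U V : List (Letter × ℕ)} (hV : ∀ x ∈ V, isLast x.1) :
    run (U ++ V) = run U + V.length := by
  have h : V.reverse.takeWhile (fun x => isLast x.1) = V.reverse :=
    List.takeWhile_eq_self_iff.2 (by simpa using hV)
  rw [run, run, List.reverse_append, List.takeWhile_append, h, if_pos rfl]
  simp [Nat.add_comm]

theorem run_append_of_exists {U V : List (Letter × ℕ)} (hV : ∃ x ∈ V, isLast x.1 = false) :
    run (U ++ V) = run V := by
  rw [run, run, List.reverse_append, List.takeWhile_append, if_neg]
  intro h
  have h' := (List.takeWhile_prefix (fun x : Letter × ℕ => isLast x.1)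
    (l := V.reverse)).eq_of_length h
  obtain ⟨x, hx, hx'⟩ := hV
  have := List.takeWhile_eq_self_iff.1 h' x (by simpa using hx)
  simp [hx'] at this

theorem run_cons_of_not {x : Letter × ℕ} {V : List (Letter × ℕ)} (hx : isLast x.1 = false) :
    run (x :: V) = run V := by
  by_cases hV : ∃ y ∈ V, isLast y.1 = false
  · exact run_append_of_exists (U := [x]) hV
  · have h : ∀ y ∈ V, isLast y.1 := by simpa using hV
    rw [show x :: V = [x] ++ V from rfl, run_append_of_all h, ← List.nil_append V,
      run_append_of_all h]
    simp [run, hx]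

/-- The number of nodes of `t`, apart from the root, that come after the last node with a right
brother. -/
def work (t : OTree) : ℕ := run (inside t)

theorem work_chain (b : ℕ) : work (chain b) = b := by
  rw [work, inside_chain, ← List.nil_append (List.replicate _ _), run_append_of_all]
  · simp [run]
  · intro x hx
    rw [(List.mem_replicate.1 hx).2]
    rfl

theorem inside_append_singleton (us : List OTree) (y : OTree) :
    inside (node (us ++ [y])) = annotateForest (us.length + 1) 1 us ++
      (childLabel (us.length + 1) (us.length + 1), us.length + 1) :: inside y := by
  simp [inside, annotateForest_append, annotateForest, annotate_eq, Nat.add_comm]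

theorem inside_append_pair (us : List OTree) (x y : OTree) :
    inside (node (us ++ [x, y])) = annotateForest (us.length + 2) 1 us ++
      (childLabel (us.length + 2) (us.length + 1), us.length + 1) ::
        (inside x ++ (Letter.r, us.length + 2) :: inside y) := by
  have : childLabel (us.length + 2) (us.length + 2) = Letter.r := by simp [childLabel]
  simp [inside, annotateForest_append, annotateForest, annotate_eq, Nat.add_comm 1, this]

theorem isLast_childLabel_left (k : ℕ) : isLast (childLabel (k + 2) (k + 1)) = false := by
  unfold childLabel
  split_ifs <;> simp_all [isLast]

/-- Read backwards, the run takes the `b + 1` letters of the final chain and then enters `x`. It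
stops at the root of `x` at the latest, because that root has a right brother. -/
theorem work_append_chain (us : List OTree) (x : OTree) (b : ℕ) :
    work (node (us ++ [x, chain b])) = work x + (b + 1) := by
  rw [work, inside_append_pair, ← List.cons_append, ← List.append_assoc, run_append_of_all]
  · rw [run_append_of_exists ⟨_, List.mem_cons_self, isLast_childLabel_left _⟩,
      run_cons_of_not (isLast_childLabel_left _)]
    simp [work, inside_chain]
  · intro x hx
    rw [inside_chain, List.mem_cons, List.mem_replicate] at hx
    rcases hx with rfl | ⟨-, rfl⟩ <;> rfl

theorem Step.exists_not_isLast {Δ : ℕ} {t t' : OTree} (h : Step Δ t t') :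
    ∃ x ∈ inside t, isLast x.1 = false := by
  induction h with
  | inner us h ih =>
    obtain ⟨x, hx, hx'⟩ := ih
    exact ⟨x, by rw [inside_append_singleton]; simp [hx], hx'⟩
  | left us b h _ =>
    exact ⟨(childLabel (us.length + 2) (us.length + 1), us.length + 1),
      by rw [inside_append_pair]; simp, isLast_childLabel_left us.length⟩
  | grow us a b =>
    exact ⟨(childLabel (us.length + 2) (us.length + 1), us.length + 1),
      by rw [inside_append_pair]; simp, isLast_childLabel_left us.length⟩

theorem work_append_singleton (us : List OTree) {y : OTree}
    (hy : ∃ x ∈ inside y, isLast x.1 = false) : work (node (us ++ [y])) = work y := by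
  rw [work, inside_append_singleton, List.append_cons, run_append_of_exists hy, work]

theorem work_lt_size (t : OTree) : work t < t.size := by
  rw [← length_inside_add_one, work, run, Nat.lt_add_one_iff]
  simpa using (List.takeWhile_sublist (fun x : Letter × ℕ => isLast x.1)
    (l := (inside t).reverse)).length_le

end OTree
open OTree

-- Total correctness with step counts

/-- The program `c` halts when started in `σ`, and its number of steps and final memory
satisfy `Q`. -/
def WP (c : Cmd) (σ : Memory) (Q : ℕ → Memory → Prop) : Prop :=
  ∃ k σ', Exec c σ k σ' ∧ Q k σ'

theorem WP.mono {c : Cmd} {σ : Memory} {P Q : ℕ → Memory → Prop} (h : WP c σ P)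
    (H : ∀ k σ', P k σ' → Q k σ') : WP c σ Q :=
  let ⟨k, σ', h₁, h₂⟩ := h
  ⟨k, σ', h₁, H _ _ h₂⟩

theorem WP_skip {σ : Memory} {Q : ℕ → Memory → Prop} : WP Cmd.skip σ Q ↔ Q 1 σ :=
  ⟨fun ⟨_, _, h, hQ⟩ => by cases h; exact hQ, fun h => ⟨_, _, .skip σ, h⟩⟩

theorem WP_set {x : Reg} {e : Expr} {σ : Memory} {Q : ℕ → Memory → Prop} :
    WP (Cmd.set x e) σ Q ↔
      Q (e.cost + 1) { σ with reg := Function.update σ.reg x (e.eval σ) } :=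
  ⟨fun ⟨_, _, h, hQ⟩ => by cases h; exact hQ, fun h => ⟨_, _, .set σ x e, h⟩⟩

theorem WP_setFlag {x : BoolVar} {b : Bool} {σ : Memory} {Q : ℕ → Memory → Prop} :
    WP (Cmd.setFlag x b) σ Q ↔ Q 1 { σ with flag := Function.update σ.flag x b } :=
  ⟨fun ⟨_, _, h, hQ⟩ => by cases h; exact hQ, fun h => ⟨_, _, .setFlag σ x b, h⟩⟩

theorem WP_putC {e : Expr} {a : Letter} {σ : Memory} {Q : ℕ → Memory → Prop} :
    WP (Cmd.putC e a) σ Q ↔ Q (e.cost + 1) { σ with C := Function.update σ.C (e.eval σ) a } :=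
  ⟨fun ⟨_, _, h, hQ⟩ => by cases h; exact hQ, fun h => ⟨_, _, .putC σ e a, h⟩⟩

theorem WP_putNChild {e f : Expr} {σ : Memory} {Q : ℕ → Memory → Prop} :
    WP (Cmd.putNChild e f) σ Q ↔ Q (e.cost + f.cost + 1)
      { σ with NChild := Function.update σ.NChild (e.eval σ) (f.eval σ) } :=
  ⟨fun ⟨_, _, h, hQ⟩ => by cases h; exact hQ, fun h => ⟨_, _, .putNChild σ e f, h⟩⟩

theorem WP_seq {c d : Cmd} {σ : Memory} {Q : ℕ → Memory → Prop} :
    WP (Cmd.seq c d) σ Q ↔ WP c σ fun k σ' => WP d σ' fun k' σ'' => Q (k + k') σ'' :=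
  ⟨fun ⟨_, _, h, hQ⟩ => by cases h with | seq h h' => exact ⟨_, _, h, _, _, h', hQ⟩,
    fun ⟨_, _, h, _, _, h', hQ⟩ => ⟨_, _, .seq h h', hQ⟩⟩

theorem WP_ite {b : Test} {c d : Cmd} {σ : Memory} {Q : ℕ → Memory → Prop} :
    WP (Cmd.ite b c d) σ Q ↔ if b.eval σ = true then WP c σ fun k σ' => Q (b.cost + 1 + k) σ'
      else WP d σ fun k σ' => Q (b.cost + 1 + k) σ' := by
  constructor
  · rintro ⟨_, _, h, hQ⟩
    cases h with
    | ite_true hb h => rw [if_pos hb]; exact ⟨_, _, h, hQ⟩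
    | ite_false hb h => rw [if_neg (by simp [hb])]; exact ⟨_, _, h, hQ⟩
  · split_ifs with hb
    · rintro ⟨_, _, h, hQ⟩
      exact ⟨_, _, .ite_true hb h, hQ⟩
    · rintro ⟨_, _, h, hQ⟩
      exact ⟨_, _, .ite_false (by simpa using hb) h, hQ⟩

theorem WP_while_false {b : Test} {c : Cmd} {σ : Memory} {Q : ℕ → Memory → Prop}
    (hb : b.eval σ = false) (h : Q (b.cost + 1) σ) : WP (Cmd.while b c) σ Q :=
  ⟨_, _, .while_false hb, h⟩

theorem WP_while_true {b : Test} {c : Cmd} {σ : Memory} {Q : ℕ → Memory → Prop}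
    (hb : b.eval σ = true)
    (h : WP c σ fun k σ' => WP (Cmd.while b c) σ' fun k' σ'' => Q (b.cost + 1 + k + k') σ'') :
    WP (Cmd.while b c) σ Q :=
  let ⟨_, _, h₁, _, _, h₂, hQ⟩ := h
  ⟨_, _, .while_true hb h₁ h₂, hQ⟩

/-- The average is stated for given running times; determinism identifies them with the executions
produced by `WP`. -/
theorem Exec.deterministic {c : Cmd} {σ σ₁ σ₂ : Memory} {k₁ k₂ : ℕ} (h₁ : Exec c σ k₁ σ₁)
    (h₂ : Exec c σ k₂ σ₂) : k₁ = k₂ ∧ σ₁ = σ₂ := by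
  induction h₁ generalizing k₂ σ₂ with
  | skip => cases h₂; exact ⟨rfl, rfl⟩
  | set => cases h₂; exact ⟨rfl, rfl⟩
  | setFlag => cases h₂; exact ⟨rfl, rfl⟩
  | putC => cases h₂; exact ⟨rfl, rfl⟩
  | putNChild => cases h₂; exact ⟨rfl, rfl⟩
  | seq _ _ ih ih' =>
    cases h₂ with
    | seq h h' =>
      obtain ⟨rfl, rfl⟩ := ih h
      obtain ⟨rfl, rfl⟩ := ih' h'
      exact ⟨rfl, rfl⟩
  | ite_true hb _ ih =>
    cases h₂ with
    | ite_true _ h => obtain ⟨rfl, rfl⟩ := ih h; exact ⟨rfl, rfl⟩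
    | ite_false hb' _ => simp [hb] at hb'
  | ite_false hb _ ih =>
    cases h₂ with
    | ite_true hb' _ => simp [hb] at hb'
    | ite_false _ h => obtain ⟨rfl, rfl⟩ := ih h; exact ⟨rfl, rfl⟩
  | while_false hb =>
    cases h₂ with
    | while_false _ => exact ⟨rfl, rfl⟩
    | while_true hb' _ _ => simp [hb] at hb'
  | while_true hb _ _ ih ih' =>
    cases h₂ with
    | while_false hb' => simp [hb] at hb'
    | while_true _ h h' =>
      obtain ⟨rfl, rfl⟩ := ih h
      obtain ⟨rfl, rfl⟩ := ih' h'
      exact ⟨rfl, rfl⟩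

-- Array segments and frame conditions

/-- From position `p` on, the arrays hold the annotated word. -/
def Seg (σ : Memory) : ℕ → List (Letter × ℕ) → Prop
  | _, [] => True
  | p, x :: W => σ.C p = x.1 ∧ σ.NChild p = x.2 ∧ Seg σ (p + 1) W

theorem Seg_append {σ : Memory} {p : ℕ} {U V : List (Letter × ℕ)} :
    Seg σ p (U ++ V) ↔ Seg σ p U ∧ Seg σ (p + U.length) V := by
  induction U generalizing p with
  | nil => simp [Seg]
  | cons x U ih => simp [Seg, ih, and_assoc, Nat.add_assoc, Nat.add_comm 1]

theorem Seg.congr {σ σ' : Memory} {p : ℕ} {W : List (Letter × ℕ)} (h : Seg σ p W)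
    (H : ∀ i, p ≤ i → i < p + W.length → σ'.C i = σ.C i ∧ σ'.NChild i = σ.NChild i) :
    Seg σ' p W := by
  induction W generalizing p with
  | nil => trivial
  | cons x W ih =>
    obtain ⟨h₁, h₂, h₃⟩ := h
    obtain ⟨h₄, h₅⟩ := H p le_rfl (by simp)
    exact ⟨h₄.trans h₁, h₅.trans h₂, ih h₃ fun i hi hi' => H i (by omega) (by
      simp only [List.length_cons]; omega)⟩

theorem Seg.C_of_replicate {σ : Memory} {p m j : ℕ} {a : Letter}
    (h : Seg σ p (List.replicate m (a, j))) : ∀ i, p ≤ i → i < p + m → σ.C i = a := by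
  induction m generalizing p with
  | zero => intro i _ _; omega
  | succ m ih =>
    rw [List.replicate_succ] at h
    intro i hi hi'
    rcases hi.eq_or_lt with rfl | hi
    · exact h.1
    · exact ih h.2.2 i hi (by omega)

theorem Seg_iff_map {σ : Memory} {p : ℕ} {W : List (Letter × ℕ)} :
    Seg σ p W ↔ (List.range W.length).map (fun i => σ.C (i + p)) = W.map Prod.fst ∧
      (List.range W.length).map (fun i => σ.NChild (i + p)) = W.map Prod.snd := by
  induction W generalizing p with
  | nil => simp [Seg]
  | cons x W ih =>
    simp only [Seg, ih, List.length_cons, List.range_succ_eq_map, List.map_cons, List.map_map,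
      List.cons.injEq, Function.comp_def, Nat.succ_eq_add_one, Nat.zero_add, Nat.add_assoc,
      Nat.add_comm p 1]
    tauto

theorem holds_iff {Δ n : ℕ} {t : OTree} (ht : t.size = n) {σ : Memory} :
    AOrder.Holds Δ n t σ ↔
      σ.reg Reg.n = n ∧ σ.reg Reg.delta = Δ ∧ Seg σ 1 (annotate Letter.s 1 t) := by
  rw [Seg_iff_map, length_annotate, ht]
  rfl

/-- Outside of positions `p, …, e - 1` of the arrays, of the variables in `S` and of the Boolean
variables in `F`, the two memories agree. -/
structure Frame (p e : ℕ) (S : List Reg) (F : List BoolVar) (σ σ' : Memory) : Prop where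
  reg : ∀ x ∉ S, σ'.reg x = σ.reg x
  flag : ∀ x ∉ F, σ'.flag x = σ.flag x
  C : ∀ i, i < p ∨ e ≤ i → σ'.C i = σ.C i
  NChild : ∀ i, i < p ∨ e ≤ i → σ'.NChild i = σ.NChild i

theorem Frame.trans {p e p₁ e₁ p₂ e₂ : ℕ} {S S₁ S₂ : List Reg} {F F₁ F₂ : List BoolVar}
    {σ σ₁ σ₂ : Memory} (h₁ : Frame p₁ e₁ S₁ F₁ σ σ₁) (h₂ : Frame p₂ e₂ S₂ F₂ σ₁ σ₂)
    (hp₁ : p ≤ p₁ := by omega) (he₁ : e₁ ≤ e := by omega)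
    (hp₂ : p ≤ p₂ := by omega) (he₂ : e₂ ≤ e := by omega)
    (hS₁ : S₁ ⊆ S := by simp) (hS₂ : S₂ ⊆ S := by simp)
    (hF₁ : F₁ ⊆ F := by simp) (hF₂ : F₂ ⊆ F := by simp) : Frame p e S F σ σ₂ where
  reg x hx := (h₂.reg x fun h => hx (hS₂ h)).trans (h₁.reg x fun h => hx (hS₁ h))
  flag x hx := (h₂.flag x fun h => hx (hF₂ h)).trans (h₁.flag x fun h => hx (hF₁ h))
  C i hi := (h₂.C i (by omega)).trans (h₁.C i (by omega))
  NChild i hi := (h₂.NChild i (by omega)).trans (h₁.NChild i (by omega))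

theorem Frame.seg {p e q : ℕ} {S : List Reg} {F : List BoolVar} {σ σ' : Memory}
    {W : List (Letter × ℕ)} (h : Frame p e S F σ σ') (hW : Seg σ q W)
    (hq : q + W.length ≤ p ∨ e ≤ q) : Seg σ' q W :=
  hW.congr fun i _ _ => ⟨h.C i (by omega), h.NChild i (by omega)⟩

-- Rebuilding first forests: `updateChildren` and `updateBrothers`

namespace AOrder

open Cmd

theorem WP_placeNextBrother {a : Letter} {x num : Reg} {σ : Memory} {p j : ℕ} (hxn : x ≠ num)
    (hx : σ.reg x = p + 1) (hj : σ.NChild p = j) :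
    WP (placeNextBrother a x num) σ fun k σ' => k ≤ 20 ∧ σ'.reg x = p + 2 ∧
      σ'.reg num = σ.reg num - 1 ∧ σ'.C (p + 1) = a ∧ σ'.NChild (p + 1) = j + 1 ∧
      Frame (p + 1) (p + 2) [x, num] [] σ σ' := by
  simp only [placeNextBrother, block, incr, decr, WP_seq, WP_putC, WP_putNChild, WP_set,
    Expr.eval, Expr.cost, hx, Nat.add_sub_cancel, hj]
  refine ⟨by omega, by simp [hxn], by simp [hxn.symm], by simp, by simp, ?_⟩
  constructor
  · intro y hy
    simp only [List.mem_cons, not_or] at hy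
    simp [Function.update, hy]
  · simp
  · intro i hi
    simp only [Function.update_apply, ite_eq_right_iff]
    omega
  · intro i hi
    simp only [Function.update_apply, ite_eq_right_iff]
    omega

/-- `w` nodes of the first forest, up to and including the rightmost root, which is node number
`j + 1` or more of its parent. -/
theorem WP_placeBrothers {x num : Reg} (hxn : x ≠ num) (hxd : Reg.delta ≠ x)
    (hnd : Reg.delta ≠ num) {Δ : ℕ} {c d j p : ℕ} {σ : Memory} (hd : 1 ≤ d) (hj : 1 ≤ j)
    (hΔ : j + d = Δ) (hδ : σ.reg Reg.delta = Δ) (hx : σ.reg x = p + 1)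
    (hc : σ.reg num = c + 1) (hN : σ.NChild p = j) :
    WP (seq (Cmd.while (roomForMiddle x num) (placeNextBrother Letter.m x num))
      (placeNextBrother Letter.r x num)) σ fun k σ' => ∃ w W, w ≤ c ∧ W.length = w + 1 ∧
        annotateForest (j + (first Δ d (c + 1)).length) (j + 1) (first Δ d (c + 1)) =
          W ++ annotateForest (first Δ Δ (c - w)).length 1 (first Δ Δ (c - w)) ∧
        Seg σ' (p + 1) W ∧ σ'.reg x = p + w + 2 ∧ σ'.reg num = c - w ∧
        Frame (p + 1) (p + w + 2) [x, num] [] σ σ' ∧ k ≤ 40 * w + 40 := by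
  -- The loop test is the negation of the case condition of `first`: since `j + d = Δ`, there is
  -- room for a middle brother exactly when `d > 1`.
  have hb : (roomForMiddle x num).eval σ = true ↔ ¬ (d ≤ 1 ∨ c = 0) := by
    simp [roomForMiddle, Test.eval, Expr.eval, hx, hN, hδ, hc]; omega
  have hcost : (roomForMiddle x num).cost = 12 := rfl
  rw [WP_seq]
  induction c generalizing d j p σ with
  | zero =>
    refine WP_while_false (by simpa using hb) ((WP_placeNextBrother hxn hx hN).mono ?_)
    rintro k σ' ⟨hk, h₁, h₂, h₃, h₄, h₅⟩
    refine ⟨0, [(Letter.r, j + 1)], le_rfl, rfl, ?_, ⟨h₃, h₄, trivial⟩, h₁, by omega, h₅,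
      by omega⟩
    have : j ≠ 0 := by omega
    simp [first, annotateForest, annotate, childLabel, this]
  | succ c ih =>
    by_cases h_end : d ≤ 1 ∨ c + 1 = 0
    · refine WP_while_false (Bool.eq_false_iff.2 fun h => hb.1 h h_end)
        ((WP_placeNextBrother hxn hx hN).mono ?_)
      rintro k σ' ⟨hk, h₁, h₂, h₃, h₄, h₅⟩
      refine ⟨0, [(Letter.r, j + 1)], by omega, rfl, ?_, ⟨h₃, h₄, trivial⟩, h₁, by omega, h₅,
        by omega⟩
      have : j ≠ 0 := by omega
      rw [first, if_pos h_end]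
      simp [annotateForest, annotate, childLabel, this]
    · refine WP_while_true (hb.2 h_end) ((WP_placeNextBrother hxn hx hN).mono ?_)
      rintro k σ₁ ⟨hk, h₁, h₂, h₃, h₄, h₅⟩
      have hδ₁ : σ₁.reg Reg.delta = Δ := by rw [h₅.reg _ (by simp [hxd, hnd]), hδ]
      have h₂' : σ₁.reg num = c + 1 := by omega
      refine (@ih (d - 1) (j + 1) (p + 1) σ₁ (by omega) (by omega) (by omega) hδ₁ h₁ h₂' h₄
        ?_).mono ?_
      · simp [roomForMiddle, Test.eval, Expr.eval, h₁, h₄, hδ₁, h₂']; omega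
      · rintro k' σ₂ h
        refine h.mono ?_
        rintro k'' σ₃ ⟨w, W, hw, hW, hF, hseg, hx', hn', hfr, hk'⟩
        refine ⟨w + 1, (Letter.m, j + 1) :: W, by omega, by simp [hW], ?_, ⟨?_, ?_, hseg⟩,
          by omega, by omega, h₅.trans hfr, by omega⟩
        · have hlen : (first Δ (d - 1) (c + 1)).length ≠ 0 :=
            length_first_ne_zero (by omega)
          rw [first, if_neg h_end, annotateForest, List.length_cons,
            show j + ((first Δ (d - 1) (c + 1)).length + 1) =
              j + 1 + (first Δ (d - 1) (c + 1)).length by omega, hF,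
            show c + 1 - (w + 1) = c - w by omega]
          have : childLabel (j + 1 + (first Δ (d - 1) (c + 1)).length) (j + 1) = Letter.m := by
            unfold childLabel
            rw [if_neg (by omega), if_neg (by omega), if_neg (by omega)]
          simp [annotate, annotateForest, this]
        · rw [hfr.C _ (by omega), h₃]
        · rw [hfr.NChild _ (by omega), h₄]

theorem WP_seq_assoc {c c' c'' : Cmd} {σ : Memory} {Q : ℕ → Memory → Prop}
    (h : WP (seq (seq c c') c'') σ Q) : WP (seq c (seq c' c'')) σ Q := by
  simpa only [WP_seq, Nat.add_assoc] using h

/-- Each pass of the outer loop writes the roots of one first forest; what is left is the first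
forest below the rightmost root. With `Δ = 1` and at least two nodes the code would still write two
children, hence `2 ≤ Δ`. -/
theorem WP_updateChildrenBody {Δ : ℕ} (hΔ : 2 ≤ Δ) {c p : ℕ} {σ : Memory}
    (hδ : σ.reg Reg.delta = Δ) (hi : σ.reg Reg.ci = p + 1) (hc : σ.reg Reg.cnum = c) :
    WP updateChildrenBody σ fun k σ' =>
      Seg σ' (p + 1) (annotateForest (first Δ Δ c).length 1 (first Δ Δ c)) ∧
      Frame (p + 1) (p + 1 + c) [Reg.ci, Reg.cnum] [] σ σ' ∧ k ≤ 60 * c + 10 := by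
  induction c using Nat.strong_induction_on generalizing p σ with
  | _ c ih =>
    obtain rfl | hpos := Nat.eq_zero_or_pos c
    · refine WP_while_false (by simp [Test.eval, Expr.eval, hc]) ?_
      exact ⟨trivial, ⟨fun _ _ => rfl, fun _ _ => rfl, fun _ _ => rfl, fun _ _ => rfl⟩,
        by simp [Test.cost, Expr.cost]⟩
    refine WP_while_true (by simpa [Test.eval, Expr.eval, hc] using hpos) ?_
    obtain rfl | hc1 := Nat.eq_or_lt_of_le (Nat.succ_le_of_lt hpos)
    · simp only [block, Cmd.when, incr, decr, WP_seq, WP_ite, WP_putC, WP_putNChild, WP_set,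
        WP_skip, Test.eval, Expr.eval, hc, hi, Nat.succ_eq_add_one, Nat.zero_add, decide_true,
        if_true, Function.update_self, ne_eq, reduceCtorEq, not_false_eq_true,
        Function.update_of_ne, Nat.sub_self, Nat.not_lt_zero, decide_false, Bool.false_eq_true,
        if_false]
      refine WP_while_false (by simp [Test.eval, Expr.eval]) ?_
      refine ⟨?_, ?_, ?_⟩
      · simp [first, annotateForest, annotate, childLabel, Seg]
      · constructor
        · intro y hy
          simp only [List.mem_cons, not_or] at hy
          simp [Function.update, hy]
        · simp
        · intro i hi
          simp only [Function.update_apply, ite_eq_right_iff]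
          omega
        · intro i hi
          simp only [Function.update_apply, ite_eq_right_iff]
          omega
      · simp [Test.cost, Expr.cost]
    · obtain ⟨c, rfl⟩ : ∃ c', c = c' + 2 := ⟨c - 2, by omega⟩
      have hne : c + 2 ≠ 1 := by omega
      have hlt : 1 < c + 2 := by omega
      simp only [block, Cmd.when, incr, decr]
      rw [WP_seq]
      simp only [WP_ite, WP_skip, Test.eval, Expr.eval, hc, hne, hlt, decide_true, decide_false,
        if_true, Bool.false_eq_true, if_false]
      rw [WP_seq, WP_putC, WP_seq, WP_putNChild, WP_seq, WP_set, WP_seq, WP_set]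
      simp only [Expr.eval, hi, hc, ne_eq, reduceCtorEq, not_false_eq_true,
        Function.update_of_ne]
      -- The letter `ℓ` is already in place as child number `1`, so `Δ - 1` slots remain.
      refine (WP_placeBrothers (Δ := Δ) (c := c) (d := Δ - 1) (j := 1) (p := p + 1) (by simp)
        (by simp) (by simp) (by omega) le_rfl (by omega) ?_ ?_ ?_ ?_).mono ?_
      · simp [hδ]
      · simp
      · simp
      · simp
      rintro k σ₁ ⟨w, W, hw, hW, hF, hseg, hi₁, hc₁, hfr, hk⟩
      have hδ₁ : σ₁.reg Reg.delta = Δ := by rw [hfr.reg _ (by simp)]; simp [hδ]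
      -- The remaining iterations of the outer loop solve the same problem for the `c - w` nodes
      -- below the rightmost root.
      refine (ih (c - w) (by omega) (p := p + w + 2) hδ₁ (by omega) hc₁).mono ?_
      rintro k' σ₂ ⟨hseg', hfr', hk'⟩
      have hfirst : first Δ Δ (c + 2) = node [] :: first Δ (Δ - 1) (c + 1) := by
        rw [first, if_neg (by omega)]
      have hlen : (first Δ (Δ - 1) (c + 1)).length ≠ 0 :=
        length_first_ne_zero (by omega)
      refine ⟨?_, ?_, ?_⟩
      · rw [hfirst, annotateForest, List.length_cons, Nat.add_comm (List.length _) 1, hF,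
          annotate, annotateForest]
        refine ⟨?_, ?_, ?_⟩
        · rw [hfr'.C _ (by omega), hfr.C _ (by omega)]
          simp [childLabel, hlen]
        · rw [hfr'.NChild _ (by omega), hfr.NChild _ (by omega)]
          simp
        · refine (Seg_append (U := W)).2 ?_
          refine ⟨hfr'.seg hseg (by omega), ?_⟩
          convert hseg' using 1
          omega
      · refine Frame.trans (p₁ := p + 1) (e₁ := p + w + 3) (S₁ := [Reg.ci, Reg.cnum])
          (F₁ := []) (σ₁ := σ₁) ?_ hfr'
        constructor
        · intro y hy
          rw [hfr.reg y hy]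
          simp only [List.mem_cons, not_or] at hy
          simp [Function.update, hy]
        · intro y hy
          rw [hfr.flag y hy]
        · intro i hi
          rw [hfr.C i (by omega)]
          simp only [Function.update_apply, ite_eq_right_iff]
          omega
        · intro i hi
          rw [hfr.NChild i (by omega)]
          simp only [Function.update_apply, ite_eq_right_iff]
          omega
      · simp only [Test.cost, Expr.cost]
        omega

theorem WP_updateChildren {Δ : ℕ} (hΔ : 2 ≤ Δ) {c p : ℕ} {e f : Expr} {σ : Memory}
    (hδ : σ.reg Reg.delta = Δ) (he : e.eval σ = p + 1)
    (hf : f.eval { σ with reg := Function.update σ.reg Reg.ci (p + 1) } = c) :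
    WP (updateChildren e f) σ fun k σ' =>
      Seg σ' (p + 1) (annotateForest (first Δ Δ c).length 1 (first Δ Δ c)) ∧
      Frame (p + 1) (p + 1 + c) [Reg.ci, Reg.cnum] [] σ σ' ∧
      k ≤ 60 * c + 12 + e.cost + f.cost := by
  simp only [updateChildren, block, WP_seq, WP_set, he, hf]
  refine (WP_updateChildrenBody hΔ (c := c) (p := p) ?_ ?_ ?_).mono ?_
  · simp [hδ]
  · simp
  · simp
  rintro k σ' ⟨hseg, hfr, hk⟩
  refine ⟨hseg, ⟨?_, hfr.flag, hfr.C, hfr.NChild⟩, by omega⟩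
  intro y hy
  rw [hfr.reg y hy]
  simp only [List.mem_cons, not_or] at hy
  simp [Function.update, hy]

/-- The first brother to be written is child number `j`, so `Δ + 1 - j` slots are left and the total
number of children is `j - 1` plus the length of the new list. -/
theorem WP_updateBrothers {Δ : ℕ} {c p j : ℕ} {e f : Expr} {σ : Memory}
    (hδ : σ.reg Reg.delta = Δ) (he : e.eval σ = p + 1)
    (hf : f.eval { σ with reg := Function.update σ.reg Reg.bi (p + 1) } = c + 1)
    (hj : 2 ≤ j) (hjΔ : j ≤ Δ) (hN : σ.NChild (p + 1) = j) :
    WP (updateBrothers e f) σ fun k σ' =>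
      Seg σ' (p + 1) (annotateForest (j - 1 + (first Δ (Δ + 1 - j) (c + 1)).length) j
        (first Δ (Δ + 1 - j) (c + 1))) ∧
      Frame (p + 1) (p + 2 + c) [Reg.ci, Reg.cnum, Reg.bi, Reg.bnum] [] σ σ' ∧
      k ≤ 60 * c + 100 + e.cost + f.cost := by
  simp only [updateBrothers, block]
  rw [WP_seq, WP_set, WP_seq, WP_set, he, hf, updateBrothersBody]
  simp only [Cmd.when, incr, decr, WP_ite, Test.eval, Expr.eval, block, ne_eq, reduceCtorEq,
    not_false_eq_true, Function.update_of_ne, Function.update_self, hN, hδ, decide_eq_true_eq]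
  obtain rfl | hc := Nat.eq_zero_or_pos c
  · simp only [Nat.zero_add, if_true, WP_seq, WP_putC, WP_set, Expr.eval, ne_eq, reduceCtorEq,
      not_false_eq_true, Function.update_of_ne, Function.update_self]
    refine ⟨?_, ?_, ?_⟩
    · have h₁ : j - 1 + 1 = j := by omega
      have h₂ : j ≠ 1 := by omega
      simp [first, annotateForest, annotate, childLabel, Seg, h₁, h₂, hN]
    · constructor
      · intro y hy
        simp only [List.mem_cons, not_or] at hy
        simp [Function.update, hy]
      · simp
      · intro i hi
        simp only [Function.update_apply, ite_eq_right_iff]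
        omega
      · simp
    · simp only [Test.cost, Expr.cost]
      omega
  · rw [if_neg (by omega), if_pos (by omega)]
    -- With one slot left, all remaining nodes go below a single last brother.
    by_cases hjΔ' : j = Δ
    · rw [if_pos hjΔ', WP_seq, WP_putC, WP_seq, WP_set, WP_seq, WP_set]
      simp only [Expr.eval, ne_eq, reduceCtorEq, not_false_eq_true, Function.update_of_ne,
        Function.update_self]
      refine (WP_updateChildren (Δ := Δ) (by omega) (c := c) (p := p + 1) ?_ ?_ ?_).mono ?_
      · simp [hδ]
      · simp [Expr.eval]
      · simp [Expr.eval]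
      rintro k σ₁ ⟨hseg, hfr, hk⟩
      have hfirst : first Δ (Δ + 1 - j) (c + 1) = [node (first Δ Δ c)] := by
        rw [first, if_pos (by omega)]
      refine ⟨?_, ?_, ?_⟩
      · have h₁ : j - 1 + 1 = j := by omega
        have h₂ : j ≠ 1 := by omega
        rw [hfirst, List.length_singleton, h₁, annotateForest, annotate, annotateForest,
          List.append_nil]
        refine ⟨?_, ?_, hseg⟩
        · rw [hfr.C _ (by omega)]
          simp [childLabel, h₂]
        · rw [hfr.NChild _ (by omega), hN]
      · constructor
        · intro y hy
          simp only [List.mem_cons, not_or] at hy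
          rw [hfr.reg y (by simp [hy])]
          simp [Function.update, hy]
        · intro y hy
          rw [hfr.flag y hy]
        · intro i hi
          rw [hfr.C i (by omega)]
          simp only [Function.update_apply, ite_eq_right_iff]
          omega
        · intro i hi
          rw [hfr.NChild i (by omega)]
      · simp only [Test.cost, Expr.cost] at hk ⊢
        omega
    · rw [if_neg hjΔ', WP_seq, WP_putC, WP_seq, WP_set, WP_seq, WP_set]
      simp only [Expr.eval, ne_eq, reduceCtorEq, not_false_eq_true, Function.update_of_ne,
        Function.update_self]
      obtain ⟨c, rfl⟩ : ∃ c', c = c' + 1 := ⟨c - 1, by omega⟩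
      -- Groups the inner loop with the placement of `r`, the unit treated by `WP_placeBrothers`.
      apply WP_seq_assoc
      rw [WP_seq]
      refine (WP_placeBrothers (Δ := Δ) (c := c) (d := Δ - j) (j := j) (p := p + 1) (by simp)
        (by simp) (by simp) (by omega) (by omega) (by omega) ?_ ?_ ?_ ?_).mono ?_
      · simp [hδ]
      · simp
      · simp
      · simp [hN]
      rintro k σ₁ ⟨w, W, hw, hW, hF, hseg, hi₁, hc₁, hfr, hk⟩
      refine (WP_updateChildren (Δ := Δ) (by omega) (c := c - w) (p := p + w + 2) ?_ ?_ ?_).mono ?_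
      · rw [hfr.reg _ (by simp)]; simp [hδ]
      · simp [Expr.eval, hi₁]; omega
      · simp [Expr.eval, hc₁]
      rintro k' σ₂ ⟨hseg', hfr', hk'⟩
      have hfirst : first Δ (Δ + 1 - j) (c + 1 + 1) = node [] :: first Δ (Δ - j) (c + 1) := by
        rw [first, if_neg (by omega), show Δ + 1 - j - 1 = Δ - j by omega]
      have hlen : (first Δ (Δ - j) (c + 1)).length ≠ 0 :=
        length_first_ne_zero (by omega)
      refine ⟨?_, ?_, ?_⟩
      · rw [hfirst, annotateForest, List.length_cons,
          show j - 1 + ((first Δ (Δ - j) (c + 1)).length + 1) =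
            j + (first Δ (Δ - j) (c + 1)).length by omega, hF, annotate, annotateForest]
        refine ⟨?_, ?_, ?_⟩
        · rw [hfr'.C _ (by omega), hfr.C _ (by omega)]
          simp only [childLabel, Function.update_self]
          rw [if_neg (by omega), if_neg (by omega), if_neg (by omega)]
        · rw [hfr'.NChild _ (by omega), hfr.NChild _ (by omega)]
          simp [hN]
        · refine (Seg_append (U := W)).2 ?_
          refine ⟨hfr'.seg hseg (by omega), ?_⟩
          convert hseg' using 1
          omega
      · refine Frame.trans (p₁ := p + 1) (e₁ := p + w + 3) (S₁ := [Reg.bi, Reg.bnum])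
          (F₁ := []) (σ₁ := σ₁) ?_ hfr'
        constructor
        · intro y hy
          rw [hfr.reg y hy]
          simp only [List.mem_cons, not_or] at hy
          simp [Function.update, hy]
        · intro y hy
          rw [hfr.flag y hy]
        · intro i hi
          rw [hfr.C i (by omega)]
          simp only [Function.update_apply, ite_eq_right_iff]
          omega
        · intro i hi
          rw [hfr.NChild i (by omega)]
      · simp only [Test.cost, Expr.cost] at hk hk' ⊢
        omega

end AOrder

-- The main loop

theorem OTree.annotateForest_congr {k k' j : ℕ} {us : List OTree}
    (h : ∀ i, j ≤ i → i < j + us.length → childLabel k i = childLabel k' i) :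
    annotateForest k j us = annotateForest k' j us := by
  induction us generalizing j with
  | nil => rfl
  | cons u us ih =>
    simp only [List.length_cons] at h
    rw [annotateForest, annotateForest, h j le_rfl (by omega),
      ih fun i hi hi' => h i (by omega) (by omega)]

/-- The label of a node that has a right brother does not depend on how many there are. Hence the
brothers left of the rewritten part keep their letters. -/
theorem OTree.childLabel_of_lt {k k' j : ℕ} (h : j < k) (h' : j < k') (hj : 1 ≤ j) :
    childLabel k j = childLabel k' j := by
  unfold childLabel
  split_ifs <;> first | rfl | omega

/-- Descending through last subtrees, one reaches a node whose last subtree is a chain with a left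
brother. The root of that chain is the final `r`, and only `s` follows. -/
theorem OTree.Step.inside_eq {Δ : ℕ} {t t' : OTree} (h : Step Δ t t') :
    ∃ U j m, inside t = U ++ (Letter.r, j) :: List.replicate m (Letter.s, 1) := by
  induction h with
  | inner us h ih =>
    obtain ⟨U, j, m, ih⟩ := ih
    rw [inside_append_singleton, ih, ← List.cons_append, ← List.append_assoc]
    exact ⟨_, _, _, rfl⟩
  | left us b h _ =>
    rw [inside_append_pair, inside_chain, ← List.cons_append, ← List.append_assoc]
    exact ⟨_, _, _, rfl⟩
  | grow us a b =>
    rw [inside_append_pair, inside_chain b, ← List.cons_append, ← List.append_assoc]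
    exact ⟨_, _, _, rfl⟩

namespace AOrder

open Cmd

/-- Serves both backward scans. The empty array range in `Frame 0 0` says that the arrays are
untouched, so the test can be evaluated on the original letters. -/
theorem WP_countDown {b : Test} {x y : Reg} (hxy : x ≠ y) {q m : ℕ} {σ : Memory}
    (hx : σ.reg x = q + m)
    (hb : ∀ σ', Frame 0 0 [x, y] [] σ σ' → ∀ l, l ≤ m → σ'.reg x = q + l →
      (b.eval σ' = true ↔ 0 < l)) :
    WP (Cmd.while b (block [incr y, decr x])) σ fun k σ' => σ'.reg x = q ∧
      σ'.reg y = σ.reg y + m ∧ Frame 0 0 [x, y] [] σ σ' ∧ k ≤ (b.cost + 9) * (m + 1) := by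
  have hrefl : ∀ σ : Memory, Frame 0 0 [x, y] [] σ σ :=
    fun σ => ⟨fun _ _ => rfl, fun _ _ => rfl, fun _ _ => rfl, fun _ _ => rfl⟩
  induction m generalizing σ with
  | zero =>
    refine WP_while_false (by simpa using hb σ (hrefl σ) 0 le_rfl hx) ?_
    exact ⟨hx, rfl, hrefl σ, by omega⟩
  | succ m ih =>
    refine WP_while_true ((hb σ (hrefl σ) (m + 1) le_rfl hx).2 (by omega)) ?_
    simp only [block, incr, decr, WP_seq, WP_set, Expr.eval, ne_eq, hxy, not_false_eq_true,
      Function.update_of_ne, hx]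
    have hfr : Frame 0 0 [x, y] [] σ ⟨Function.update (Function.update σ.reg y (σ.reg y + 1)) x
        (q + (m + 1) - 1), σ.flag, σ.C, σ.NChild⟩ := by
      refine ⟨?_, fun _ _ => rfl, fun _ _ => rfl, fun _ _ => rfl⟩
      intro z hz
      simp only [List.mem_cons, not_or] at hz
      simp [Function.update, hz]
    refine (ih (σ := ⟨_, σ.flag, σ.C, σ.NChild⟩) (by simp) ?_).mono ?_
    · intro σ' h l hl hx'
      exact hb σ' (hfr.trans h) l (by omega) hx'
    · rintro k σ' ⟨h₁, h₂, h₃, h₄⟩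
      refine ⟨h₁, ?_, hfr.trans h₃, ?_⟩
      · rw [h₂]; simp [hxy.symm]; omega
      · simp only [Expr.cost]
        rw [Nat.mul_succ]
        omega

/-- The integer variables that the main loop changes. -/
abbrev loopRegs : List Reg := [.i, .sNum, .current, .stSize, .ci, .cnum, .bi, .bnum]

/-- Covers the rule `left`: a preceding `r` shows that the left brother is not a chain. All `b + 1`
nodes of the final chain stay to its right, and the loop moves on to position `z` inside the
brother. -/
theorem WP_caseR_right {Δ b q z m j : ℕ} {σ : Memory} (hδ : σ.reg Reg.delta = Δ)
    (hcur : σ.reg Reg.current = q + 1) (hst : σ.reg Reg.stSize = b + 1) (hz : q = z + m)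
    (hr : σ.C z = Letter.r) (hs : ∀ i, z < i → i ≤ q → σ.C i = Letter.s)
    (hj : 2 ≤ j) (hjΔ : j ≤ Δ) (hN : σ.NChild (q + 1) = j) :
    WP caseR σ fun k σ' =>
      Seg σ' (q + 1) (annotateForest (j - 1 + (first Δ (Δ + 1 - j) (b + 1)).length) j
        (first Δ (Δ + 1 - j) (b + 1))) ∧
      σ'.reg Reg.current = z ∧ σ'.reg Reg.stSize = m ∧
      Frame (q + 1) (q + 2 + b) loopRegs [] σ σ' ∧ k ≤ 60 * b + 11 * m + 150 := by
  simp only [caseR, block]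
  rw [WP_seq, WP_set, WP_seq, WP_set, WP_seq]
  refine (WP_countDown (q := z) (m := m) (by simp) ?_ ?_).mono ?_
  · simp [Expr.eval, hcur, hz]
  · intro σ' hfr l hl hi
    simp only [Test.eval, Expr.eval, hi, decide_eq_true_eq, hfr.C _ (Or.inr (Nat.zero_le _))]
    constructor
    · intro h
      by_contra hl0
      obtain rfl : l = 0 := by omega
      simp [hr] at h
    · intro h
      exact hs _ (by omega) (by omega)
  rintro k σ₁ ⟨hi₁, hn₁, hfr, hk⟩
  simp only [Function.update_self, Expr.eval, Nat.zero_add] at hn₁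
  have hC : σ₁.C z = Letter.r := (hfr.C _ (by omega)).trans hr
  have hcur₁ : σ₁.reg Reg.current = q + 1 := by rw [hfr.reg _ (by simp)]; simp [hcur]
  have hst₁ : σ₁.reg Reg.stSize = b + 1 := by rw [hfr.reg _ (by simp)]; simp [hst]
  have hδ₁ : σ₁.reg Reg.delta = Δ := by rw [hfr.reg _ (by simp)]; simp [hδ]
  have hN₁ : σ₁.NChild (q + 1) = j := by rw [hfr.NChild _ (by omega)]; exact hN
  rw [WP_ite]
  simp only [Test.eval, Expr.eval, hi₁, hC, decide_true, if_true]
  rw [WP_seq]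
  refine (WP_updateBrothers (p := q) (c := b) (j := j) hδ₁
    (by simpa [Expr.eval] using hcur₁) ?_ hj hjΔ hN₁).mono ?_
  · simp [Expr.eval, hst₁]
  rintro k' σ₂ ⟨hseg, hfr₂, hk'⟩
  simp only [WP_seq, WP_set, Expr.eval, ne_eq, reduceCtorEq, not_false_eq_true,
    Function.update_of_ne, Function.update_self]
  refine ⟨hseg.congr fun _ _ _ => ⟨rfl, rfl⟩, ?_, ?_, ?_, ?_⟩
  · rw [hfr₂.reg _ (by simp), hi₁]
  · rw [hfr₂.reg _ (by simp), hn₁]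
  · constructor
    · intro y hy
      simp only [List.mem_cons, not_or] at hy
      simp only [Function.update, hy, dite_false]
      rw [hfr₂.reg y (by simp [hy]), hfr.reg y (by simp [hy])]
      simp [Function.update, hy]
    · intro y hy
      exact (hfr₂.flag y hy).trans (hfr.flag y hy)
    · intro i hi
      exact (hfr₂.C i (by omega)).trans (hfr.C i (by omega))
    · intro i hi
      exact (hfr₂.NChild i (by omega)).trans (hfr.NChild i (by omega))
  · simp only [Test.cost, Expr.cost] at hk hk' ⊢
    omega

/-- Covers the first iteration of the rule `grow`: the preceding letter that is not `s` is the root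
of the left brother, which is then a chain. One node passes to the brother, so the remaining `b`
nodes start one position later; `b = 0` means that nothing is left to its right. -/
theorem WP_caseR_left {Δ b q z m j : ℕ} {σ : Memory} (hδ : σ.reg Reg.delta = Δ)
    (hcur : σ.reg Reg.current = q + 1) (hst : σ.reg Reg.stSize = b + 1) (hz : q = z + m)
    (hr : σ.C z = Letter.m ∨ σ.C z = Letter.l) (hs : ∀ i, z < i → i ≤ q → σ.C i = Letter.s)
    (hj : 2 ≤ j) (hjΔ : j ≤ Δ) (hN : σ.NChild (q + 1) = j)
    (hdel : σ.flag BoolVar.rDeleted = false) :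
    WP caseR σ fun k σ' =>
      Seg σ' (q + 2) (annotateForest (j - 1 + (first Δ (Δ + 1 - j) b).length) j
        (first Δ (Δ + 1 - j) b)) ∧
      σ'.reg Reg.current = z ∧ σ'.reg Reg.stSize = m + 1 ∧
      σ'.flag BoolVar.rDeleted = decide (b = 0) ∧
      Frame (q + 2) (q + 2 + b) loopRegs [BoolVar.rDeleted] σ σ' ∧
      k ≤ 60 * b + 11 * m + 200 := by
  simp only [caseR, block]
  rw [WP_seq, WP_set, WP_seq, WP_set, WP_seq]
  refine (WP_countDown (q := z) (m := m) (by simp) ?_ ?_).mono ?_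
  · simp [Expr.eval, hcur, hz]
  · intro σ' hfr l hl hi
    simp only [Test.eval, Expr.eval, hi, decide_eq_true_eq, hfr.C _ (Or.inr (Nat.zero_le _))]
    constructor
    · intro h
      by_contra hl0
      obtain rfl : l = 0 := by omega
      rcases hr with hr | hr <;> simp [hr] at h
    · intro h
      exact hs _ (by omega) (by omega)
  rintro k σ₁ ⟨hi₁, hn₁, hfr, hk⟩
  simp only [Function.update_self, Expr.eval, Nat.zero_add] at hn₁
  have hC : σ₁.C z = σ.C z := hfr.C _ (by omega)
  have hcur₁ : σ₁.reg Reg.current = q + 1 := by rw [hfr.reg _ (by simp)]; simp [hcur]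
  have hst₁ : σ₁.reg Reg.stSize = b + 1 := by rw [hfr.reg _ (by simp)]; simp [hst]
  have hδ₁ : σ₁.reg Reg.delta = Δ := by rw [hfr.reg _ (by simp)]; simp [hδ]
  have hN₁ : σ₁.NChild (q + 1) = j := by rw [hfr.NChild _ (by omega)]; exact hN
  have hr' : ¬ σ.C z = Letter.r := by rcases hr with hr | hr <;> simp [hr]
  rw [WP_ite]
  simp only [Test.eval, Expr.eval, hi₁, hC, hr', decide_false, Bool.false_eq_true, if_false,
    Cmd.when]
  rw [WP_ite]
  simp only [Test.eval, Expr.eval, hi₁, hC, Bool.or_eq_true, decide_eq_true_eq, hr, if_true]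
  rw [WP_seq, WP_ite]
  simp only [Test.eval, Expr.eval, hst₁, decide_eq_true_eq, Nat.add_eq_right]
  obtain rfl | hb := Nat.eq_zero_or_pos b
  · simp only [if_true, WP_seq, WP_set, WP_setFlag, Expr.eval, ne_eq, reduceCtorEq,
      not_false_eq_true, Function.update_of_ne, Function.update_self]
    refine ⟨trivial, hi₁, by rw [hn₁], by simp, ?_, ?_⟩
    · constructor
      · intro y hy
        simp only [List.mem_cons, not_or] at hy
        simp only [Function.update, hy, dite_false]
        rw [hfr.reg y (by simp [hy])]
        simp [Function.update, hy]
      · intro y hy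
        simp only [List.mem_cons, not_or] at hy
        simp only [Function.update, hy, dite_false]
        exact hfr.flag y (by simp)
      · intro i hi
        exact hfr.C i (by omega)
      · intro i hi
        exact hfr.NChild i (by omega)
    · simp only [Test.cost, Expr.cost] at hk ⊢
      omega
  · rw [if_neg (by omega), WP_ite]
    simp only [Test.eval, Expr.eval, hst₁, decide_eq_true_eq]
    rw [if_pos (by omega)]
    obtain ⟨b, rfl⟩ : ∃ b', b = b' + 1 := ⟨b - 1, by omega⟩
    simp only [decr]
    rw [WP_seq, WP_set, WP_seq, WP_putNChild]
    refine (WP_updateBrothers (Δ := Δ) (p := q + 1) (c := b) (j := j) ?_ ?_ ?_ hj hjΔ ?_).mono ?_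
    · simp [hδ₁]
    · simp [Expr.eval, hcur₁]
    · simp [Expr.eval, hst₁]
    · simp [Expr.eval, hcur₁, hN₁]
    rintro k' σ₂ ⟨hseg, hfr₂, hk'⟩
    simp only [WP_seq, WP_set, Expr.eval, ne_eq, reduceCtorEq, not_false_eq_true,
      Function.update_of_ne, Function.update_self]
    refine ⟨hseg.congr fun _ _ _ => ⟨rfl, rfl⟩, ?_, ?_, ?_, ?_, ?_⟩
    · rw [hfr₂.reg _ (by simp)]; simp [hi₁]
    · rw [hfr₂.reg _ (by simp)]; simp [hn₁]
    · rw [hfr₂.flag _ (by simp)]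
      simpa [hdel] using hfr.flag BoolVar.rDeleted (by simp)
    · constructor
      · intro y hy
        simp only [List.mem_cons, not_or] at hy
        simp only [Function.update, hy, dite_false]
        rw [hfr₂.reg y (by simp [hy])]
        simp only [Function.update, hy, dite_false]
        rw [hfr.reg y (by simp [hy])]
        simp [Function.update, hy]
      · intro y hy
        exact (hfr₂.flag y (by simp)).trans (hfr.flag y (by simp))
      · intro i hi
        exact (hfr₂.C i (by omega)).trans (hfr.C i (by omega))
      · intro i hi
        rw [hfr₂.NChild i (by omega)]
        simp only [Expr.eval, Function.update_apply, reduceCtorEq, if_false, hcur₁]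
        rw [if_neg (by omega)]
        exact hfr.NChild i (by omega)
    · simp only [Test.cost, Expr.cost] at hk hk' ⊢
      omega

theorem WP_caseLeftBrother {Δ c z : ℕ} {a : Letter} {σ : Memory} (hΔ : 2 ≤ Δ)
    (hδ : σ.reg Reg.delta = Δ) (hcur : σ.reg Reg.current = z) (hst : σ.reg Reg.stSize = c + 1) :
    WP (caseLeftBrother a) σ fun k σ' =>
      σ'.C z = (if σ.flag BoolVar.rDeleted then a else σ.C z) ∧ σ'.NChild z = σ.NChild z ∧
      Seg σ' (z + 1) (annotateForest (first Δ Δ c).length 1 (first Δ Δ c)) ∧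
      σ'.flag BoolVar.finished = true ∧
      Frame z (z + 1 + c) loopRegs [BoolVar.finished] σ σ' ∧ k ≤ 60 * c + 50 := by
  simp only [caseLeftBrother, block, Cmd.when]
  rw [WP_seq]
  have H : WP (Cmd.ite (Test.flag BoolVar.rDeleted) (putC (v Reg.current) a) Cmd.skip) σ
      fun k σ' => k ≤ 5 ∧ σ' = ⟨σ.reg, σ.flag, Function.update σ.C z
        (if σ.flag BoolVar.rDeleted then a else σ.C z), σ.NChild⟩ := by
    rw [WP_ite]
    by_cases h : σ.flag BoolVar.rDeleted = true
    · simp [WP_putC, Test.eval, Expr.eval, Expr.cost, hcur, h, Test.cost]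
    · simp [WP_skip, Test.eval, h, Test.cost]
  refine H.mono ?_
  rintro k σ₁ ⟨hk, rfl⟩
  rw [WP_seq]
  refine (WP_updateChildren hΔ (c := c) (p := z) ?_ ?_ ?_).mono ?_
  · exact hδ
  · simp [Expr.eval, hcur]
  · simp [Expr.eval, hst]
  rintro k' σ₂ ⟨hseg, hfr, hk'⟩
  rw [WP_setFlag]
  refine ⟨?_, ?_, hseg.congr fun _ _ _ => ⟨rfl, rfl⟩, by simp, ?_, ?_⟩
  · change σ₂.C z = _
    rw [hfr.C _ (by omega)]; simp
  · exact hfr.NChild _ (by omega)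
  · constructor
    · intro y hy
      simp only [List.mem_cons, not_or] at hy
      exact hfr.reg y (by simp [hy])
    · intro y hy
      simp only [List.mem_cons, not_or] at hy
      simp only [Function.update, hy, dite_false]
      exact hfr.flag y (by simp)
    · intro i hi
      change σ₂.C i = _
      rw [hfr.C i (by omega)]
      simp only [Function.update_apply, ite_eq_right_iff]
      omega
    · intro i hi
      exact hfr.NChild i (by omega)
  · simp only [Expr.cost] at hk' ⊢
    omega

/-- The memory after `STSize++`. -/
def incrStSize (σ : Memory) : Memory :=
  { σ with reg := Function.update σ.reg Reg.stSize (σ.reg Reg.stSize + 1) }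

theorem frame_incrStSize (σ : Memory) : Frame 0 0 [Reg.stSize] [] σ (incrStSize σ) := by
  refine ⟨?_, fun _ _ => rfl, fun _ _ => rfl, fun _ _ => rfl⟩
  intro y hy
  simp only [List.mem_cons, not_or] at hy
  simp [incrStSize, Function.update, hy]

theorem WP_mainLoop_of_r {σ : Memory} {Q : ℕ → Memory → Prop}
    (hfin : σ.flag BoolVar.finished = false) (hr : σ.C (σ.reg Reg.current) = Letter.r)
    (h : WP caseR (incrStSize σ) fun k σ' => WP mainLoop σ' fun k' σ'' => Q (10 + k + k') σ'') :
    WP mainLoop σ Q := by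
  refine WP_while_true (by simp [Test.eval, hfin]) ?_
  simp only [block, incr]
  rw [WP_seq, WP_set, WP_ite, if_pos (by simp [Test.eval, Expr.eval, hr])]
  refine h.mono fun k σ' h => h.mono fun k' σ'' h => ?_
  simp only [Test.cost, Expr.cost]
  convert h using 1
  omega

/-- The branches for `m` and `ℓ` pass different numbers of tests; asking for `Q` at every count up
to `k + 20` covers both. -/
theorem WP_mainLoop_of_left {σ : Memory} {Q : ℕ → Memory → Prop} {a : Letter}
    (hfin : σ.flag BoolVar.finished = false)
    (ha : σ.C (σ.reg Reg.current) = Letter.m ∧ a = Letter.r ∨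
      σ.C (σ.reg Reg.current) = Letter.l ∧ a = Letter.s)
    (h : WP (caseLeftBrother a) (incrStSize σ) fun k σ' =>
      σ'.flag BoolVar.finished = true ∧ ∀ k', k' ≤ k + 20 → Q k' σ') :
    WP mainLoop σ Q := by
  refine WP_while_true (by simp [Test.eval, hfin]) ?_
  have H : ∀ σ', σ'.flag BoolVar.finished = true →
      Test.eval σ' (Test.not (Test.flag BoolVar.finished)) = false := fun σ' h => by
    simp [Test.eval, h]
  simp only [block, incr]
  rcases ha with ⟨ha, rfl⟩ | ⟨ha, rfl⟩
  · rw [WP_seq, WP_set, WP_ite, if_neg (by simp [Test.eval, Expr.eval, ha]), WP_ite,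
      if_pos (by simp [Test.eval, Expr.eval, ha])]
    refine h.mono fun k σ' h => WP_while_false (H _ h.1) (h.2 _ ?_)
    simp only [Test.cost, Expr.cost]
    omega
  · rw [WP_seq, WP_set, WP_ite, if_neg (by simp [Test.eval, Expr.eval, ha]), WP_ite,
      if_neg (by simp [Test.eval, Expr.eval, ha]), Cmd.when, WP_ite,
      if_pos (by simp [Test.eval, Expr.eval, ha])]
    refine h.mono fun k σ' h => WP_while_false (H _ h.1) (h.2 _ ?_)
    simp only [Test.cost, Expr.cost]
    omega

theorem last_r_unique {C : ℕ → Letter} {q q' e : ℕ} (hq : C q = Letter.r)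
    (hs : ∀ i, q < i → i < e → C i = Letter.s) (hq' : C q' = Letter.r)
    (hs' : ∀ i, q' < i → i < e → C i = Letter.s) (h : q < e) (h' : q' < e) : q = q' := by
  rcases lt_trichotomy q q' with hlt | heq | hlt
  · have := hs q' hlt h'; simp [hq'] at this
  · exact heq
  · have := hs' q hlt h; simp [hq] at this

theorem seg_node_append {σ : Memory} {a : Letter} {p j : ℕ} {us vs : List OTree} :
    Seg σ (p + 1) (annotate a j (node (us ++ vs))) ↔
      σ.C (p + 1) = a ∧ σ.NChild (p + 1) = j ∧
      Seg σ (p + 2) (annotateForest (us.length + vs.length) 1 us) ∧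
      Seg σ (p + 2 + forestSize us)
        (annotateForest (us.length + vs.length) (us.length + 1) vs) := by
  rw [annotate_eq]
  change _ ∧ _ ∧ Seg σ (p + 2) (annotateForest (us ++ vs).length 1 (us ++ vs)) ↔ _
  rw [annotateForest_append, Seg_append, length_annotateForest, List.length_append,
    Nat.add_comm 1]

theorem seg_forest_cons {σ : Memory} {k p j : ℕ} {t : OTree} {ts : List OTree} :
    Seg σ p (annotateForest k j (t :: ts)) ↔
      Seg σ p (annotate (childLabel k j) j t) ∧
      Seg σ (p + t.size) (annotateForest k (j + 1) ts) := by
  rw [annotateForest, Seg_append, length_annotate]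

theorem seg_chain {σ : Memory} {a : Letter} {p j b : ℕ}
    (h : Seg σ p (annotate a j (chain b))) :
    σ.C p = a ∧ σ.NChild p = j ∧ ∀ i, p < i → i < p + 1 + b → σ.C i = Letter.s := by
  rw [annotate_eq, inside_chain] at h
  exact ⟨h.1, h.2.1, fun i hi hi' => h.2.2.C_of_replicate i hi hi'⟩

/-- The induction runs along `Step`, with the tree stored anywhere in the array. The term `20 * m`
is a credit for the `m` final letters `s`: it pays for the scan over them, which precedes the
iteration that needs their number. The constant `500` leaves room for it and for rebuilding. -/
theorem WP_mainLoop {Δ : ℕ} {t t' : OTree} (h : Step Δ t t') (hT : IsT Δ t) {σ : Memory}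
    {p q m j : ℕ} {a : Letter} (hδ : σ.reg Reg.delta = Δ)
    (hfin : σ.flag BoolVar.finished = false) (hdel : σ.flag BoolVar.rDeleted = false)
    (hseg : Seg σ (p + 1) (annotate a j t)) (hcur : σ.reg Reg.current = q)
    (hst : σ.reg Reg.stSize = m) (hq : q + m = p + t.size) (hr : σ.C q = Letter.r)
    (hs : ∀ i, q < i → i < p + 1 + t.size → σ.C i = Letter.s) :
    WP mainLoop σ fun k σ' => Seg σ' (p + 1) (annotate a j t') ∧
      Frame (p + 1) (p + 1 + t.size) loopRegs [BoolVar.finished, BoolVar.rDeleted] σ σ' ∧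
      k + 20 * m ≤ 500 * work t := by
  induction h generalizing σ p q m j a with
  | @inner us y y' h ih =>
    obtain ⟨h₁, h₂, h₃, h₄⟩ := seg_node_append.1 hseg
    rw [seg_forest_cons] at h₄
    simp only [size, forestSize_append, forestSize, Nat.add_zero] at hq hs ⊢
    refine (ih ((isT_node.1 hT).2 y (by simp)) hδ hfin hdel (p := p + 1 + forestSize us)
      (by convert h₄.1 using 1; omega) hcur hst (by omega) hr
      fun i hi hi' => hs i hi (by omega)).mono ?_
    rintro k σ' ⟨hseg', hfr, hk⟩
    refine ⟨seg_node_append.2 ⟨?_, ?_, hfr.seg h₃ ?_, seg_forest_cons.2 ⟨?_, trivial⟩⟩, ?_, ?_⟩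
    · rw [hfr.C _ (by omega), h₁]
    · rw [hfr.NChild _ (by omega), h₂]
    · rw [length_annotateForest]; omega
    · convert hseg' using 1
      · omega
      · rfl
    · exact ⟨hfr.reg, hfr.flag, fun i hi => hfr.C i (by omega),
        fun i hi => hfr.NChild i (by omega)⟩
    · rwa [work_append_singleton us h.exists_not_isLast]
  | @left us b x x' h ih =>
    obtain ⟨h₁, h₂, h₃, h₄⟩ := seg_node_append.1 hseg
    obtain ⟨hlen, hmem⟩ := isT_node.1 hT
    simp only [List.length_append, List.length_cons, List.length_nil] at hlen
    rw [seg_forest_cons, seg_forest_cons] at h₄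
    obtain ⟨hx, hy, -⟩ := h₄
    obtain ⟨hy₁, hy₂, hy₃⟩ := seg_chain hy
    have hlabel : childLabel (us.length + 2) (us.length + 1 + 1) = Letter.r := by
      simp [childLabel]
    simp only [List.length_cons, List.length_nil, Nat.zero_add, hlabel] at hy₁
    simp only [size, forestSize_append, forestSize, size_chain, Nat.add_zero] at hq hs ⊢
    obtain ⟨U, jj, mm, hU⟩ := h.inside_eq
    have hUlen := length_inside_add_one x
    rw [hU] at hUlen
    simp only [List.length_append, List.length_cons, List.length_replicate] at hUlen
    -- The segment has only one last `r`: the root of the final chain.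
    obtain rfl : q = p + 2 + forestSize us + x.size :=
      last_r_unique (e := p + 2 + forestSize us + x.size + b + 1) hr
        (fun i hi hi' => hs i hi (by omega)) hy₁ (fun i hi hi' => hy₃ i hi (by omega))
        (by omega) (by omega)
    obtain rfl : m = b := by omega
    have hx' := hx
    rw [annotate_eq, hU, ← List.cons_append, Seg_append] at hx'
    have hzr := hx'.2.1
    have hzs := hx'.2.2.2.C_of_replicate
    simp only [List.length_cons] at hzr hzs
    set z := p + 2 + forestSize us + (U.length + 1) with hz
    have hfr₀ := frame_incrStSize σ
    refine WP_mainLoop_of_r hfin (by rw [hcur]; exact hr) ?_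
    refine (WP_caseR_right (Δ := Δ) (b := m) (q := p + 1 + forestSize us + x.size) (z := z)
      (m := mm) (j := us.length + 2) ?_ ?_ ?_ ?_ ?_ ?_ ?_ ?_ ?_).mono ?_
    · rw [hfr₀.reg _ (by simp), hδ]
    · rw [hfr₀.reg _ (by simp), hcur]; omega
    · simp [incrStSize, hst]
    · omega
    · exact hzr
    · intro i hi hi'
      exact hzs i hi (by omega)
    · omega
    · omega
    · change σ.NChild _ = _
      rw [show p + 1 + forestSize us + x.size + 1 = p + 2 + forestSize us + x.size by omega, hy₂]
    rintro k₁ σ₁ ⟨hseg₁, hcur₁, hst₁, hfr₁, hk₁⟩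
    have hfr₂ : Frame (p + 2 + forestSize us + x.size)
        (p + 1 + (forestSize us + (x.size + (m + 1)) + 1)) loopRegs [] σ σ₁ :=
      ⟨fun y hy => (hfr₁.reg y hy).trans (hfr₀.reg y (by simp at hy ⊢; tauto)),
        fun y hy => (hfr₁.flag y hy).trans (hfr₀.flag y hy),
        fun i hi => hfr₁.C i (by omega), fun i hi => hfr₁.NChild i (by omega)⟩
    -- The iteration ends in the entry state for `x`: `Current` is at its last `r` and `STSize`
    -- counts the `s` behind it.
    refine (ih (hmem x (by simp)) (p := p + 1 + forestSize us) (q := z) (m := mm)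
      (j := us.length + 1) (a := childLabel (us.length + 2) (us.length + 1))
      ?_ ?_ ?_ ?_ hcur₁ hst₁ ?_ ?_ ?_).mono ?_
    · rw [hfr₂.reg _ (by simp), hδ]
    · rw [hfr₂.flag _ (by simp), hfin]
    · rw [hfr₂.flag _ (by simp), hdel]
    · refine hfr₂.seg ?_ (by rw [length_annotate]; omega)
      convert hx using 1
      · omega
      · rfl
    · omega
    · rw [hfr₂.C _ (by omega), hzr]
    · intro i hi hi'
      rw [hfr₂.C _ (by omega)]
      exact hzs i hi (by omega)
    rintro k₂ σ₂ ⟨hseg₂, hfr₃, hk₂⟩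
    have hlen' : (first Δ (Δ - us.length - 1) (m + 1)).length ≠ 0 :=
      length_first_ne_zero (by omega)
    refine ⟨seg_node_append.2 ⟨?_, ?_, ?_, seg_forest_cons.2 ⟨?_, ?_⟩⟩, ?_, ?_⟩
    · rw [hfr₃.C _ (by omega), hfr₂.C _ (by omega), h₁]
    · rw [hfr₃.NChild _ (by omega), hfr₂.NChild _ (by omega), h₂]
    · rw [annotateForest_congr (k' := us.length + [x, chain m].length)]
      · refine hfr₃.seg (hfr₂.seg h₃ ?_) ?_ <;> rw [length_annotateForest] <;> omega
      · intro i hi hi'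
        refine childLabel_of_lt ?_ ?_ hi <;> simp only [List.length_cons] <;> omega
    · convert hseg₂ using 1
      · omega
      · rw [childLabel_of_lt (k' := us.length + 2)] <;> (try simp only [List.length_cons]) <;>
          omega
    · have hsz := h.size_eq
      refine hfr₃.seg ?_ (by omega)
      convert hseg₁ using 1
      · rw [h.size_eq]; omega
      · rw [show Δ + 1 - (us.length + 2) = Δ - us.length - 1 by omega, List.length_cons]
        congr 1; omega
    · exact hfr₂.trans hfr₃
    · rw [work_append_chain]
      omega
  | grow us c b =>
    obtain ⟨h₁, h₂, h₃, h₄⟩ := seg_node_append.1 hseg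
    obtain ⟨hlen, hmem⟩ := isT_node.1 hT
    simp only [List.length_append, List.length_cons, List.length_nil] at hlen
    rw [seg_forest_cons, seg_forest_cons, size_chain] at h₄
    obtain ⟨hx, hy, -⟩ := h₄
    obtain ⟨hx₁, hx₂, hx₃⟩ := seg_chain hx
    obtain ⟨hy₁, hy₂, hy₃⟩ := seg_chain hy
    have hlabel : childLabel (us.length + 2) (us.length + 1 + 1) = Letter.r := by
      simp [childLabel]
    simp only [List.length_cons, List.length_nil, Nat.zero_add, hlabel] at hy₁ hx₁
    simp only [size, forestSize_append, forestSize, size_chain, Nat.add_zero] at hq hs ⊢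
    obtain rfl : q = p + 2 + forestSize us + (c + 1) :=
      last_r_unique (e := p + 2 + forestSize us + (c + 1) + b + 1) hr
        (fun i hi hi' => hs i hi (by omega)) hy₁ (fun i hi hi' => hy₃ i hi (by omega))
        (by omega) (by omega)
    obtain rfl : m = b := by omega
    set z := p + 2 + forestSize us with hz
    have hzl : σ.C z = Letter.m ∧ us ≠ [] ∨ σ.C z = Letter.l ∧ us = [] := by
      rw [hx₁]
      rcases us with _ | ⟨u, us⟩
      · right; simp [childLabel]
      · left; simp [childLabel]
    have hfr₀ := frame_incrStSize σ
    refine WP_mainLoop_of_r hfin (by rw [hcur]; exact hr) ?_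
    refine (WP_caseR_left (σ := incrStSize σ) (Δ := Δ) (b := m) (q := z + c) (z := z) (m := c)
      (j := us.length + 2) ?_ ?_ ?_ rfl ?_ ?_ ?_ ?_ ?_ hdel).mono ?_
    · rw [hfr₀.reg _ (by simp), hδ]
    · rw [hfr₀.reg _ (by simp), hcur]; omega
    · simp [incrStSize, hst]
    · exact hzl.imp And.left And.left
    · intro i hi hi'
      exact hx₃ i hi (by omega)
    · omega
    · omega
    · exact hy₂
    rintro k₁ σ₁ ⟨hseg₁, hcur₁, hst₁, hdel₁, hfr₁, hk₁⟩
    have hfr₂ : Frame (z + c + 2) (z + c + 2 + m) loopRegs [BoolVar.rDeleted] σ σ₁ :=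
      ⟨fun y hy => (hfr₁.reg y hy).trans (hfr₀.reg y (by simp at hy ⊢; tauto)),
        fun y hy => (hfr₁.flag y hy).trans (hfr₀.flag y (by simp)),
        fun i hi => hfr₁.C i (by omega), fun i hi => hfr₁.NChild i (by omega)⟩
    have hfr₃ := frame_incrStSize σ₁
    have hCz : σ₁.C z = σ.C z := hfr₂.C _ (by omega)
    -- The left brother is labeled `ℓ` when `us` is empty and `m` otherwise. If its right brother
    -- disappears, it becomes an only child `s` or a last child `r` accordingly.
    refine WP_mainLoop_of_left (a := if us = [] then Letter.s else Letter.r) ?_ ?_ ?_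
    · rw [hfr₂.flag _ (by simp), hfin]
    · rw [hcur₁, hCz]
      rcases hzl with ⟨h, h'⟩ | ⟨h, h'⟩ <;> simp [h, h']
    refine (WP_caseLeftBrother (Δ := Δ) (c := c + 1) (z := z) (by omega) ?_ ?_ ?_).mono ?_
    · rw [hfr₃.reg _ (by simp), hfr₂.reg _ (by simp), hδ]
    · rw [hfr₃.reg _ (by simp), hcur₁]
    · simp [incrStSize, hst₁]
    rintro k₂ σ₂ ⟨hC₂, hN₂, hseg₂, hfin₂, hfr₄, hk₂⟩
    refine ⟨hfin₂, fun k hk => ⟨seg_node_append.2 ⟨?_, ?_, ?_, seg_forest_cons.2 ⟨?_, ?_⟩⟩, ?_, ?_⟩⟩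
    · rw [hfr₄.C _ (by omega), hfr₃.C _ (by omega), hfr₂.C _ (by omega), h₁]
    · rw [hfr₄.NChild _ (by omega), hfr₃.NChild _ (by omega), hfr₂.NChild _ (by omega), h₂]
    · rw [annotateForest_congr (k' := us.length + [chain c, chain m].length)]
      · refine hfr₄.seg (hfr₃.seg (hfr₂.seg h₃ ?_) ?_) ?_ <;> rw [length_annotateForest] <;> omega
      · intro i hi hi'
        refine childLabel_of_lt ?_ ?_ hi <;> simp only [List.length_cons] <;> omega
    · rw [annotate_eq]
      refine ⟨?_, ?_, hseg₂⟩
      · rw [hC₂]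
        change (if σ₁.flag _ = true then _ else σ₁.C z) = _
        rw [hdel₁, hCz]
        -- For `m = 0` the new list of right brothers is empty and the node is relabeled; for `m >
        -- 0` it still has a right brother and keeps its letter.
        obtain rfl | hm := Nat.eq_zero_or_pos m
        · rcases us with _ | ⟨u, us⟩ <;> simp [first, childLabel]
        · have hlen' : (first Δ (Δ - us.length - 1) m).length ≠ 0 :=
            length_first_ne_zero (by omega)
          rw [if_neg (by simp; omega), hx₁]
          refine childLabel_of_lt ?_ ?_ (by omega) <;> (try simp only [List.length_cons]) <;> omega
      · rw [hN₂]
        change σ₁.NChild z = _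
        rw [hfr₂.NChild _ (by omega), hx₂]
    · have hsz : z + (node (first Δ Δ (c + 1))).size = z + c + 2 := by
        simp [size, forestSize_first]; omega
      rw [hsz]
      refine hfr₄.seg (hfr₃.seg ?_ (by omega)) (by omega)
      convert hseg₁ using 1
      rw [show Δ + 1 - (us.length + 2) = Δ - us.length - 1 by omega, List.length_cons]
      congr 1; omega
    · refine Frame.trans hfr₂ (Frame.trans (p := z) (e := z + 1 + (c + 1)) (S := loopRegs)
        (F := [BoolVar.finished]) (p₁ := z) (e₁ := z) (σ₁ := incrStSize σ₁)
        (S₁ := [Reg.stSize]) (F₁ := []) ?_ hfr₄)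
      exact ⟨hfr₃.reg, hfr₃.flag, fun i _ => rfl, fun i _ => rfl⟩
    · rw [work_append_chain, work_chain]
      omega

-- The whole algorithm

/-- Initialization and first scan, common to both outcomes: `q = 0` is the case of a chain,
otherwise `q` is the last position whose letter is not `s`. Each scanned letter costs `15` steps. -/
theorem WP_next {n q m : ℕ} {σ : Memory} {Q : ℕ → Memory → Prop} (hn : σ.reg Reg.n = n)
    (hq : n = q + m) (hC : q = 0 ∨ σ.C q ≠ Letter.s)
    (hs : ∀ i, q < i → i ≤ n → σ.C i = Letter.s)
    (h : ∀ σ₁, Frame 0 0 [Reg.current, Reg.stSize]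
      [BoolVar.noSuccessor, BoolVar.rDeleted, BoolVar.finished] σ σ₁ →
      σ₁.reg Reg.current = q → σ₁.reg Reg.stSize = m →
      σ₁.flag BoolVar.noSuccessor = false → σ₁.flag BoolVar.rDeleted = false →
      σ₁.flag BoolVar.finished = false →
      WP (if q = 0 then setFlag BoolVar.noSuccessor true else mainLoop) σ₁
        fun k σ' => ∀ k', k' ≤ 15 * m + k + 40 → Q k' σ') :
    WP next σ Q := by
  simp only [next, block]
  rw [WP_seq, WP_setFlag, WP_seq, WP_set, WP_seq, WP_set, WP_seq, WP_setFlag, WP_seq,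
    WP_setFlag, WP_seq]
  refine (WP_countDown (q := q) (m := m) (by simp) ?_ ?_).mono ?_
  · simp [Expr.eval, hn, hq]
  · intro σ' hfr l hl hi
    simp only [Test.eval, Expr.eval, hi, Bool.and_eq_true, decide_eq_true_eq,
      hfr.C _ (Or.inr (Nat.zero_le _))]
    constructor
    · rintro ⟨h, h'⟩
      by_contra hl0
      obtain rfl : l = 0 := by omega
      rcases hC with rfl | hC
      · omega
      · exact hC h
    · intro h
      exact ⟨hs _ (by omega) (by omega), by omega⟩
  rintro k σ₁ ⟨hi₁, hn₁, hfr, hk⟩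
  simp only [Function.update_self, Expr.eval, Nat.zero_add] at hn₁
  have hfr' : Frame 0 0 [Reg.current, Reg.stSize]
      [BoolVar.noSuccessor, BoolVar.rDeleted, BoolVar.finished] σ σ₁ := by
    refine ⟨?_, ?_, hfr.C, hfr.NChild⟩
    · intro y hy
      rw [hfr.reg y hy]
      simp only [List.mem_cons, not_or] at hy
      simp [Function.update, hy]
    · intro y hy
      rw [hfr.flag y (by simp)]
      simp only [List.mem_cons, not_or] at hy
      simp [Function.update, hy]
  have H := h σ₁ hfr' hi₁ (by simpa using hn₁) (by rw [hfr.flag _ (by simp)]; simp)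
    (by rw [hfr.flag _ (by simp)]; simp) (by rw [hfr.flag _ (by simp)]; simp)
  rw [WP_ite]
  simp only [Test.eval, Expr.eval, hi₁, decide_eq_true_eq]
  simp only [Test.cost, Expr.cost] at hk ⊢
  split_ifs at H ⊢ with hq0
  all_goals
    refine H.mono fun k' σ' hQ => hQ _ ?_
    omega

theorem WP_next_chain {Δ n k : ℕ} {σ : Memory} (hk : k + 1 = n)
    (h : Holds Δ n (chain k) σ) : WP next σ fun K σ' => K ≤ 15 * n + 41 ∧
      σ'.flag BoolVar.noSuccessor = true ∧ Holds Δ n (chain k) σ' := by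
  rw [holds_iff (by simpa using hk)] at h
  obtain ⟨hn, hδ, hseg⟩ := h
  obtain ⟨h₁, -, h₃⟩ := seg_chain hseg
  refine WP_next (q := 0) (m := n) hn (by simp) (.inl rfl) ?_ ?_
  · intro i hi hi'
    rcases Nat.eq_or_lt_of_le (Nat.succ_le_of_lt hi) with rfl | hi
    · exact h₁
    · exact h₃ i hi (by omega)
  intro σ₁ hfr _ _ _ _ _
  rw [if_pos rfl, WP_setFlag]
  refine fun k' hk' => ⟨by omega, by simp, ?_⟩
  rw [holds_iff (by simpa using hk)]
  refine ⟨?_, ?_, ?_⟩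
  · exact (hfr.reg _ (by simp)).trans hn
  · exact (hfr.reg _ (by simp)).trans hδ
  · exact hseg.congr fun i _ _ => ⟨hfr.C i (by omega), hfr.NChild i (by omega)⟩

theorem WP_next_step {Δ n : ℕ} {t t' : OTree} {σ : Memory} (h : Step Δ t t') (hT : IsT Δ t)
    (ht : t.size = n) (hσ : Holds Δ n t σ) : WP next σ fun K σ' => K ≤ 500 * work t + 40 ∧
      σ'.flag BoolVar.noSuccessor = false ∧ Holds Δ n t' σ' := by
  rw [holds_iff ht] at hσ
  obtain ⟨hn, hδ, hseg⟩ := hσ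
  obtain ⟨U, j, m, hU⟩ := h.inside_eq
  have hlen := length_inside_add_one t
  rw [hU] at hlen
  simp only [List.length_append, List.length_cons, List.length_replicate] at hlen
  have hseg' := hseg
  rw [annotate_eq, hU, ← List.cons_append, Seg_append] at hseg'
  have hr := hseg'.2.1
  have hs := hseg'.2.2.2.C_of_replicate
  simp only [List.length_cons] at hr hs
  refine WP_next (q := U.length + 2) (m := m) hn (by omega) (.inr ?_) ?_ ?_
  · rw [show U.length + 2 = 1 + (U.length + 1) by omega, hr]; simp
  · intro i hi hi'
    exact hs i (by omega) (by omega)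
  intro σ₁ hfr hcur hst hno hdel hfin
  rw [if_neg (by omega)]
  refine (WP_mainLoop h hT (p := 0) ?_ hfin hdel (a := Letter.s) (j := 1) ?_ hcur hst ?_ ?_
    ?_).mono ?_
  · rw [hfr.reg _ (by simp), hδ]
  · exact hseg.congr fun i _ _ => ⟨hfr.C i (by omega), hfr.NChild i (by omega)⟩
  · omega
  · rw [hfr.C _ (by omega), show U.length + 2 = 1 + (U.length + 1) by omega, hr]
  · intro i hi hi'
    rw [hfr.C _ (by omega)]
    exact hs i (by omega) (by omega)
  rintro k σ₂ ⟨hseg₂, hfr₂, hk⟩ k' hk'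
  refine ⟨by omega, ?_, ?_⟩
  · rw [hfr₂.flag _ (by simp), hno]
  · rw [holds_iff (by rw [h.size_eq, ht])]
    refine ⟨?_, ?_, hseg₂⟩
    · rw [hfr₂.reg _ (by simp), hfr.reg _ (by simp), hn]
    · rw [hfr₂.reg _ (by simp), hfr.reg _ (by simp), hδ]

/-- Running time of the algorithm in terms of `work`. -/
theorem exec_next_le {Δ n : ℕ} {t : OTree} {σ σ' : Memory} {k : ℕ} (ht : t ∈ treeClass Δ n)
    (hσ : Holds Δ n t σ) (h : Exec next σ k σ') : k ≤ 500 * work t + 60 := by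
  rw [mem_treeClass] at ht
  rcases eq_chain_or_step (Δ := Δ) t with ⟨b, rfl⟩ | ⟨t', hstep⟩
  · rw [size_chain] at ht
    obtain ⟨k', σ₁, h', hk', -⟩ := WP_next_chain ht.2 hσ
    rw [(h.deterministic h').1, work_chain]
    omega
  · obtain ⟨k', σ₁, h', hk', -⟩ := WP_next_step hstep ht.1 ht.2 hσ
    rw [(h.deterministic h').1]
    omega

theorem exec_next_correct {Δ n : ℕ} {t : OTree} {σ : Memory} (ht : t ∈ treeClass Δ n)
    (hσ : Holds Δ n t σ) : ∃ (k : ℕ) (σ' : Memory), Exec next σ k σ' ∧ k ≤ 560 * n ∧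
      (∀ t', IsNext Δ n t t' → σ'.flag BoolVar.noSuccessor = false ∧ Holds Δ n t' σ') ∧
      ((∀ u ∈ treeClass Δ n, ¬ ALt t u) →
        σ'.flag BoolVar.noSuccessor = true ∧ Holds Δ n t σ') := by
  have ht' := mem_treeClass.1 ht
  have hwork := work_lt_size t
  rcases eq_chain_or_step (Δ := Δ) t with ⟨b, rfl⟩ | ⟨t', hstep⟩
  · obtain ⟨k, σ', h, hk, h₁, h₂⟩ := WP_next_chain (by simpa using ht'.2) hσ
    have := exec_next_le ht hσ h
    refine ⟨k, σ', h, by omega, ?_, fun _ => ⟨h₁, h₂⟩⟩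
    rintro t' ⟨h₃, h₄, -⟩
    rw [mem_treeClass] at h₃
    rw [size_chain] at ht'
    exact absurd h₄ (not_ALt_chain (by omega))
  · obtain ⟨k, σ', h, hk, h₁, h₂⟩ := WP_next_step hstep ht'.1 ht'.2 hσ
    have := exec_next_le ht hσ h
    refine ⟨k, σ', h, by omega, ?_, ?_⟩
    · intro t'' h₃
      obtain rfl := hstep.eq_of_isNext ht h₃
      exact ⟨h₁, h₂⟩
    · intro h₃
      exact absurd hstep.lt (h₃ t' (mem_treeClass.2 ⟨hstep.isT ht'.1, by
        rw [hstep.size_eq, ht'.2]⟩))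

end AOrder
-- Marked nodes and the ratio of consecutive class sizes
namespace OTree

theorem induction_children {P : OTree → Prop} (h : ∀ ts, (∀ t ∈ ts, P t) → P (node ts))
    (t : OTree) : P t := by
  induction hn : t.size using Nat.strong_induction_on generalizing t with
  | _ n ih =>
    subst hn
    obtain ⟨ts⟩ := t
    refine h ts fun t ht => ih _ ?_ t rfl
    have := size_le_forestSize ht
    simp only [size]; omega

/-- Contexts: the brothers to the left and to the right along the path from the root to a node. -/
abbrev Ctx := List (List OTree × List OTree)

/-- The tree with the subtree `x` in the context. -/
def plug : Ctx → OTree → OTree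
  | [], x => x
  | (l, r) :: c, x => node (l ++ plug c x :: r)

mutual
/-- The nodes of a tree, each given by its context and its subtree. -/
def locs : OTree → List (Ctx × OTree)
  | node ts => ([], node ts) :: locsForest [] ts
/-- The nodes of a list of trees that has `l` to its left. -/
def locsForest (l : List OTree) : List OTree → List (Ctx × OTree)
  | [] => []
  | t :: ts => (locs t).map (fun x => ((l, ts) :: x.1, x.2)) ++ locsForest (l ++ [t]) ts
end

theorem mem_locsForest {l ts : List OTree} {c : Ctx} {x : OTree} :
    (c, x) ∈ locsForest l ts ↔ ∃ us t vs c', ts = us ++ t :: vs ∧ c = (l ++ us, vs) :: c' ∧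
      (c', x) ∈ locs t := by
  induction ts generalizing l with
  | nil => simp [locsForest]
  | cons a as ih =>
    rw [locsForest, List.mem_append, ih]
    constructor
    · rintro (h | ⟨us, t, vs, c', rfl, rfl, h⟩)
      · simp only [List.mem_map, Prod.mk.injEq, Prod.exists] at h
        obtain ⟨c', x, h, rfl, rfl⟩ := h
        exact ⟨[], a, as, c', rfl, by simp, h⟩
      · exact ⟨a :: us, t, vs, c', rfl, by simp, h⟩
    · rintro ⟨us, t, vs, c', h₁, rfl, h⟩
      rcases us with _ | ⟨u, us⟩
      · obtain ⟨rfl, rfl⟩ : a = t ∧ as = vs := by simpa using h₁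
        left
        simp only [List.mem_map, Prod.mk.injEq, Prod.exists]
        exact ⟨c', x, h, by simp, rfl⟩
      · obtain ⟨rfl, rfl⟩ : a = u ∧ as = us ++ t :: vs := by simpa using h₁
        exact .inr ⟨us, t, vs, c', rfl, by simp, h⟩

/-- A marked node of `t` is the same thing as a decomposition of `t` into a context and a subtree,
so surgery at a node becomes a map on pairs. -/
theorem mem_locs {c : Ctx} {x t : OTree} : (c, x) ∈ locs t ↔ plug c x = t := by
  induction c generalizing t with
  | nil =>
    obtain ⟨ts⟩ := t
    simp [locs, mem_locsForest, plug]
  | cons f c ih =>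
    obtain ⟨ts⟩ := t
    obtain ⟨l, r⟩ := f
    simp only [locs, List.mem_cons, Prod.mk.injEq, reduceCtorEq, false_and, false_or,
      mem_locsForest, List.nil_append, plug, node.injEq, List.cons.injEq]
    constructor
    · rintro ⟨us, t, vs, c', rfl, ⟨⟨rfl, rfl⟩, rfl⟩, h⟩
      rw [ih.1 h]
    · rintro rfl
      exact ⟨l, _, r, c, rfl, ⟨⟨rfl, rfl⟩, rfl⟩, ih.2 rfl⟩

theorem nodup_locs (t : OTree) : (locs t).Nodup := by
  induction t using induction_children with
  | _ ts ih =>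
    have H : ∀ us l, (∀ u ∈ us, (locs u).Nodup) → (locsForest l us).Nodup := by
      intro us
      induction us with
      | nil => simp [locsForest]
      | cons u us ihu =>
        intro l h
        rw [locsForest, List.nodup_append']
        refine ⟨(h u (by simp)).map ?_, ihu _ fun v hv => h v (by simp [hv]), ?_⟩
        · rintro ⟨c, x⟩ ⟨c', x'⟩ h
          simpa using h
        · rintro ⟨c, x⟩ h₁ h₂
          simp only [List.mem_map, Prod.mk.injEq, Prod.exists] at h₁
          obtain ⟨c₁, _, -, rfl, -⟩ := h₁
          obtain ⟨us', t, vs, c₂, -, h, -⟩ := mem_locsForest.1 h₂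
          simp only [List.cons.injEq, Prod.mk.injEq] at h
          -- Nodes in different subtrees differ in the number of left brothers at the top level of
          -- their contexts.
          have := congrArg List.length h.1.1
          simp at this
    rw [locs, List.nodup_cons]
    refine ⟨?_, H ts [] ih⟩
    rw [mem_locsForest]
    simp

/-- The number of children of the root. -/
def degree : OTree → ℕ
  | node ts => ts.length

/-- The list of subtrees of the root. -/
def children : OTree → List OTree
  | node ts => ts

theorem length_locs (t : OTree) : (locs t).length = t.size := by
  induction t using induction_children with
  | _ ts ih =>
    have H : ∀ us l, (∀ u ∈ us, (locs u).length = u.size) →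
        (locsForest l us).length = forestSize us := by
      intro us
      induction us with
      | nil => simp [locsForest, forestSize]
      | cons u us ihu =>
        intro l h
        rw [locsForest, List.length_append, List.length_map, h u (by simp),
          ihu _ fun v hv => h v (by simp [hv]), forestSize]
    rw [locs, List.length_cons, H ts [] ih, size]

theorem sum_degree_locs (t : OTree) :
    ((locs t).map fun x => degree x.2).sum + 1 = t.size := by
  induction t using induction_children with
  | _ ts ih =>
    have H : ∀ us l, (∀ u ∈ us, ((locs u).map fun x => degree x.2).sum + 1 = u.size) →
        ((locsForest l us).map fun x => degree x.2).sum + us.length = forestSize us := by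
      intro us
      induction us with
      | nil => simp [locsForest, forestSize]
      | cons u us ihu =>
        intro l h
        have h₁ := h u (by simp)
        have h₂ := ihu (l ++ [u]) fun v hv => h v (by simp [hv])
        rw [locsForest, List.map_append, List.sum_append, List.map_map, forestSize, ← h₁, ← h₂,
          List.length_cons]
        simp only [Function.comp_def]
        omega
    have := H ts [] ih
    rw [locs, List.map_cons, List.sum_cons, degree, size, ← this]
    omega

/-- Equivalent to having more leaves than nodes with at least two children. Strictness drives the
induction: each child contributes a slack of one, and two of them pay for a branching root. -/
theorem size_lt_countP_locs (t : OTree) :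
    t.size < 2 * (locs t).countP (fun x => degree x.2 = 0) +
      (locs t).countP (fun x => degree x.2 = 1) := by
  induction t using induction_children with
  | _ ts ih =>
    have H : ∀ us l, (∀ u ∈ us, u.size < 2 * (locs u).countP (fun x => degree x.2 = 0) +
          (locs u).countP (fun x => degree x.2 = 1)) →
        forestSize us + us.length ≤ 2 * (locsForest l us).countP (fun x => degree x.2 = 0) +
          (locsForest l us).countP (fun x => degree x.2 = 1) := by
      intro us
      induction us with
      | nil => simp [forestSize]
      | cons u us ihu =>
        intro l h
        have h₁ := h u (by simp)
        have h₂ := ihu (l ++ [u]) fun v hv => h v (by simp [hv])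
        rw [locsForest, List.countP_append, List.countP_append, List.countP_map,
          List.countP_map, forestSize, List.length_cons]
        simp only [Function.comp_def]
        omega
    have := H ts [] ih
    rw [locs, List.countP_cons, List.countP_cons, size, degree]
    simp only [decide_eq_true_eq]
    split_ifs <;> omega

/-- The number of nodes of a context. -/
def ctxSize (c : Ctx) : ℕ := (c.map fun f => forestSize f.1 + forestSize f.2 + 1).sum

theorem size_plug (c : Ctx) (x : OTree) : (plug c x).size = ctxSize c + x.size := by
  induction c with
  | nil => simp [plug, ctxSize]
  | cons f c ih =>
    obtain ⟨l, r⟩ := f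
    simp only [ctxSize] at ih
    simp [plug, ctxSize, size, forestSize_append, forestSize, ih]
    omega

theorem plug_append (c c' : Ctx) (x : OTree) : plug (c ++ c') x = plug c (plug c' x) := by
  induction c with
  | nil => rfl
  | cons f c ih => obtain ⟨l, r⟩ := f; simp [plug, ih]

theorem isT_plug {Δ : ℕ} {c : Ctx} {x y : OTree} (h : IsT Δ (plug c x)) (hy : IsT Δ y) :
    IsT Δ (plug c y) := by
  induction c with
  | nil => exact hy
  | cons f c ih =>
    obtain ⟨l, r⟩ := f
    simp only [plug, isT_node, List.length_append, List.length_cons, List.mem_append,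
      List.mem_cons] at h ⊢
    refine ⟨h.1, ?_⟩
    rintro t (ht | rfl | ht)
    · exact h.2 t (.inl ht)
    · exact ih (h.2 _ (.inr (.inl rfl)))
    · exact h.2 t (.inr (.inr ht))

theorem isT_of_plug {Δ : ℕ} {c : Ctx} {x : OTree} (h : IsT Δ (plug c x)) : IsT Δ x := by
  induction c with
  | nil => exact h
  | cons f c ih =>
    obtain ⟨l, r⟩ := f
    exact ih ((isT_node.1 h).2 _ (by simp))

open Classical in
/-- The nodes, with a property, of the trees of a class. -/
noncomputable def nodesOf (Δ n : ℕ) (P : OTree → Prop) : Finset (Ctx × OTree) :=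
  (treeClass Δ n).biUnion fun t => ((locs t).filter fun x => P x.2).toFinset

theorem mem_nodesOf {Δ n : ℕ} {P : OTree → Prop} {c : Ctx} {x : OTree} :
    (c, x) ∈ nodesOf Δ n P ↔ plug c x ∈ treeClass Δ n ∧ P x := by
  classical
  simp only [nodesOf, Finset.mem_biUnion, List.mem_toFinset, List.mem_filter, mem_locs,
    decide_eq_true_eq]
  constructor
  · rintro ⟨t, h, rfl, hP⟩; exact ⟨h, hP⟩
  · rintro ⟨h, hP⟩; exact ⟨_, h, rfl, hP⟩

theorem sum_nodesOf (Δ n : ℕ) (P : OTree → Prop) [DecidablePred P] (f : Ctx × OTree → ℕ) :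
    ∑ x ∈ nodesOf Δ n P, f x =
      ∑ t ∈ treeClass Δ n, (((locs t).filter fun x => P x.2).map f).sum := by
  classical
  rw [nodesOf, Finset.sum_biUnion]
  · refine Finset.sum_congr rfl fun t _ => ?_
    rw [List.sum_toFinset _ ((nodup_locs t).filter _)]
    congr!
  · intro t _ u _ hne
    rw [Function.onFun, Finset.disjoint_left]
    rintro ⟨c, x⟩ h₁ h₂
    simp only [List.mem_toFinset, List.mem_filter, mem_locs] at h₁ h₂
    exact hne (h₁.1.symm.trans h₂.1)

theorem card_nodesOf (Δ n : ℕ) (P : OTree → Prop) [DecidablePred P] :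
    (nodesOf Δ n P).card = ∑ t ∈ treeClass Δ n, (locs t).countP fun x => P x.2 := by
  rw [Finset.card_eq_sum_ones, sum_nodesOf]
  simp [List.countP_eq_length_filter]

/-- Contracting the marked node with its only child is undone by inserting a node above the marked
one, and a tree with `n` nodes offers `n` such places. -/
theorem card_unary_nodes (Δ n : ℕ) :
    (nodesOf Δ (n + 1) fun x => degree x = 1).card ≤ n * (treeClass Δ n).card := by
  classical
  have h : (nodesOf Δ (n + 1) fun x => degree x = 1) ⊆
      (nodesOf Δ n fun _ => True).image fun x => (x.1, node [x.2]) := by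
    rintro ⟨c, ⟨ts⟩⟩ h
    rw [mem_nodesOf, mem_treeClass] at h
    obtain ⟨⟨h₁, h₂⟩, h₃⟩ := h
    obtain ⟨x, rfl⟩ := List.length_eq_one_iff.1 h₃
    rw [Finset.mem_image]
    refine ⟨(c, x), ?_, rfl⟩
    rw [mem_nodesOf, mem_treeClass]
    refine ⟨⟨isT_plug h₁ ((isT_node.1 (isT_of_plug h₁)).2 x (by simp)), ?_⟩, trivial⟩
    rw [size_plug] at h₂ ⊢
    simp only [size, forestSize] at h₂
    omega
  refine (Finset.card_le_card h).trans (Finset.card_image_le.trans ?_)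
  rw [card_nodesOf, mul_comm, ← smul_eq_mul, ← Finset.sum_const]
  refine Finset.sum_le_sum fun t ht => ?_
  rw [← (mem_treeClass.1 ht).2, ← length_locs t]
  exact List.countP_le_length

/-- A deleted leaf is recovered from its parent and its place among the brothers. A node with `d`
children offers `d + 1` places; in a tree with `n + 1` nodes these add up to `n + (n + 1)`. -/
theorem card_leaves (Δ n : ℕ) :
    (nodesOf Δ (n + 2) fun x => degree x = 0).card ≤ (2 * n + 1) * (treeClass Δ (n + 1)).card := by
  classical
  have h : (nodesOf Δ (n + 2) fun x => degree x = 0) ⊆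
      ((nodesOf Δ (n + 1) fun _ => True).sigma fun x => Finset.range (degree x.2 + 1)).image
        fun x => (x.1.1 ++ [(x.1.2.children.take x.2, x.1.2.children.drop x.2)], node []) := by
    rintro ⟨c, ⟨ts⟩⟩ h
    rw [mem_nodesOf, mem_treeClass] at h
    obtain ⟨⟨h₁, h₂⟩, h₃⟩ := h
    obtain rfl := List.length_eq_zero_iff.1 h₃
    rw [Finset.mem_image]
    rcases c.eq_nil_or_concat with rfl | ⟨c, ⟨l, r⟩, rfl⟩
    · simp [plug, size, forestSize] at h₂
    · rw [List.concat_eq_append] at h₁ h₂ ⊢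
      rw [plug_append] at h₁ h₂
      have h₄ := isT_node.1 (isT_of_plug h₁)
      refine ⟨⟨(c, node (l ++ r)), l.length⟩, ?_, by simp [children]⟩
      rw [Finset.mem_sigma, mem_nodesOf, mem_treeClass]
      refine ⟨⟨⟨isT_plug h₁ (isT_node.2 ⟨?_, fun t ht => h₄.2 t ?_⟩), ?_⟩, trivial⟩, ?_⟩
      · simp only [List.length_append, List.length_cons] at h₄ ⊢
        omega
      · simp only [List.mem_append, List.mem_cons] at ht ⊢
        tauto
      · rw [size_plug] at h₂ ⊢
        simp only [plug, size, forestSize, forestSize_append] at h₂ ⊢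
        omega
      · simp [degree]
  refine (Finset.card_le_card h).trans (Finset.card_image_le.trans ?_)
  rw [Finset.card_sigma, sum_nodesOf, mul_comm, ← smul_eq_mul, ← Finset.sum_const]
  refine Finset.sum_le_sum fun t ht => ?_
  have h₁ := sum_degree_locs t
  have h₂ := length_locs t
  rw [(mem_treeClass.1 ht).2] at h₁ h₂
  simp only [Finset.card_range, decide_true, List.filter_true, List.sum_map_add,
    List.map_const', List.sum_replicate, h₂, smul_eq_mul]
  omega

/-- Double counting of marked leaves, with weight two, and of marked nodes with one child: each tree
carries total weight above its size, while the two reductions bound the sum from above. -/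
theorem card_treeClass_succ_le (Δ n : ℕ) (hn : 1 ≤ n) :
    (treeClass Δ (n + 1)).card ≤ 5 * (treeClass Δ n).card := by
  obtain ⟨n, rfl⟩ : ∃ m, n = m + 1 := ⟨n - 1, by omega⟩
  have h₁ := card_leaves Δ n
  have h₂ := card_unary_nodes Δ (n + 1)
  rw [card_nodesOf] at h₁ h₂
  have h₃ : (n + 3) * (treeClass Δ (n + 2)).card ≤
      2 * ∑ t ∈ treeClass Δ (n + 2), (locs t).countP (fun x => degree x.2 = 0) +
        ∑ t ∈ treeClass Δ (n + 2), (locs t).countP (fun x => degree x.2 = 1) := by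
    rw [mul_comm, ← smul_eq_mul, ← Finset.sum_const, Finset.mul_sum, ← Finset.sum_add_distrib]
    refine Finset.sum_le_sum fun t ht => ?_
    have := size_lt_countP_locs t
    rw [(mem_treeClass.1 ht).2] at this
    omega
  -- The upper bounds add up to `2 * (2 * n + 1) + (n + 1) = 5 * n + 3`.
  have h₄ : (n + 3) * (treeClass Δ (n + 2)).card ≤ (n + 3) * (5 * (treeClass Δ (n + 1)).card) := by
    nlinarith
  exact Nat.le_of_mul_le_mul_left h₄ (by omega)

-- Surgery at the last node and the average of `work`

/-- The tree `x` with additional levels above it; on each level, `x` comes last, after the given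
brothers. -/
def plugLast : List (List OTree) → OTree → OTree
  | [], x => x
  | us :: A, x => node (us ++ [plugLast A x])

theorem plugLast_append (A B : List (List OTree)) (x : OTree) :
    plugLast (A ++ B) x = plugLast A (plugLast B x) := by
  induction A with
  | nil => rfl
  | cons us A ih => simp [plugLast, ih]

theorem exists_eq_plugLast (t : OTree) : ∃ A, t = plugLast A (node []) := by
  induction t using induction_children with
  | _ ts ih =>
    rcases ts.eq_nil_or_concat with rfl | ⟨us, y, rfl⟩
    · exact ⟨[], rfl⟩
    · obtain ⟨A, hA⟩ := ih y (by simp)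
      exact ⟨us :: A, by simp [plugLast, ← hA]⟩

theorem plugLast_node_nil_injective : Function.Injective fun A => plugLast A (node []) := by
  intro A
  induction A with
  | nil => intro B h; cases B <;> simp [plugLast] at h ⊢
  | cons us A ih =>
    intro B h
    cases B with
    | nil => simp [plugLast] at h
    | cons vs B =>
      simp only [plugLast, node.injEq] at h
      obtain ⟨rfl, h⟩ := List.append_inj' h rfl
      rw [ih (a₂ := B) (by simpa using h)]

theorem size_plugLast (A : List (List OTree)) (x : OTree) :
    (plugLast A x).size + 1 = (plugLast A (node [])).size + x.size := by
  induction A with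
  | nil => simp [plugLast, size, forestSize]; omega
  | cons us A ih => simp only [plugLast, size, forestSize_append, forestSize]; omega

theorem isT_plugLast {Δ : ℕ} {A : List (List OTree)} {x y : OTree} (h : IsT Δ (plugLast A x))
    (hy : IsT Δ y) : IsT Δ (plugLast A y) := by
  induction A with
  | nil => exact hy
  | cons us A ih =>
    simp only [plugLast, isT_node, List.length_append, List.mem_append, List.mem_singleton,
      List.length_singleton] at h ⊢
    refine ⟨h.1, ?_⟩
    rintro t (ht | rfl)
    · exact h.2 t (.inl ht)
    · exact ih (h.2 _ (.inr rfl))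

theorem isT_of_plugLast {Δ : ℕ} {A : List (List OTree)} {x : OTree} (h : IsT Δ (plugLast A x)) :
    IsT Δ x := by
  induction A with
  | nil => exact h
  | cons us A ih => exact ih ((isT_node.1 h).2 _ (by simp))

/-- The left brothers of the nodes, other than the root, on the path from the root to the last
node. -/
noncomputable def spine (t : OTree) : List (List OTree) := (exists_eq_plugLast t).choose

theorem plugLast_spine (t : OTree) : plugLast (spine t) (node []) = t :=
  (exists_eq_plugLast t).choose_spec.symm

theorem spine_plugLast (A : List (List OTree)) : spine (plugLast A (node [])) = A :=
  plugLast_node_nil_injective (plugLast_spine _)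

theorem spine_injective : Function.Injective spine := fun t u h => by
  rw [← plugLast_spine t, h, plugLast_spine]

/-- The tree obtained from `t` by giving the last node the children `us` and a further leaf. -/
noncomputable def extend (us : List OTree) (t : OTree) : OTree :=
  plugLast (spine t) (node (us ++ [node []]))

theorem spine_extend (us : List OTree) (t : OTree) : spine (extend us t) = spine t ++ [us] := by
  rw [← spine_plugLast (spine t ++ [us]), plugLast_append]
  rfl

theorem extend_mem {Δ n : ℕ} {us : List OTree} {t : OTree} (ht : t ∈ treeClass Δ n)
    (hlen : us.length < Δ) (hus : ∀ u ∈ us, IsT Δ u) :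
    extend us t ∈ treeClass Δ (n + 1 + forestSize us) := by
  rw [mem_treeClass] at ht ⊢
  constructor
  · refine isT_plugLast (x := node []) (by rw [plugLast_spine]; exact ht.1) (isT_node.2 ⟨?_, ?_⟩)
    · simp; omega
    · intro u hu
      rcases List.mem_append.1 hu with hu | hu
      · exact hus u hu
      · rw [List.mem_singleton.1 hu]; simp [isT_node]
  · have := size_plugLast (spine t) (node (us ++ [node []]))
    rw [plugLast_spine] at this
    simp only [size, forestSize_append, forestSize] at this
    rw [extend]
    omega

theorem inside_plugLast_chain_one (A : List (List OTree)) :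
    inside (plugLast A (chain 1)) = inside (plugLast A (node [])) ++ [(Letter.s, 1)] := by
  induction A with
  | nil =>
    change inside (chain 1) = inside (chain 0) ++ _
    rw [inside_chain, inside_chain]
    rfl
  | cons us A ih => simp [plugLast, inside_append_singleton, ih]

/-- An only child of the last node adds one letter `s` at the end of the codeword. -/
theorem work_extend_nil (t : OTree) : work (extend [] t) = work t + 1 := by
  change work (plugLast (spine t) (chain 1)) = _
  rw [work, inside_plugLast_chain_one, plugLast_spine, run_append_of_all]
  · rfl
  · intro x hx; rw [List.mem_singleton.1 hx]; rfl

/-- The last node is an `r` and counts once; the run then continues in `w` and cannot pass its root.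
The levels above do not matter, which is why the second claim is carried through the induction. -/
theorem work_plugLast_pair (A : List (List OTree)) (us : List OTree) (w : OTree) :
    work (plugLast A (node (us ++ [w, node []]))) = work w + 1 ∧
      ∃ x ∈ inside (plugLast A (node (us ++ [w, node []]))), isLast x.1 = false := by
  induction A with
  | nil =>
    refine ⟨work_append_chain us w 0, (childLabel (us.length + 2) (us.length + 1),
      us.length + 1), ?_, isLast_childLabel_left us.length⟩
    rw [plugLast, inside_append_pair]; simp
  | cons vs A ih =>
    obtain ⟨x, hx, hx'⟩ := ih.2
    refine ⟨(work_append_singleton vs ih.2).trans ih.1, x, ?_, hx'⟩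
    rw [plugLast, inside_append_singleton]
    simp [hx]

/-- The left brother of the last node. -/
noncomputable def lastBrother (t : OTree) : OTree := ((spine t).getLastD []).getLastD (node [])

/-- The part of a tree that remains when the last node has its left brother removed. -/
noncomputable def lastContext (t : OTree) : List (List OTree) × List OTree :=
  ((spine t).dropLast, ((spine t).getLastD []).dropLast)

/-- The tree whose last node has left brothers `us` and `w`. -/
def withBrother (κ : List (List OTree) × List OTree) (w : OTree) : OTree :=
  plugLast κ.1 (node (κ.2 ++ [w, node []]))

theorem spine_withBrother (κ : List (List OTree) × List OTree) (w : OTree) :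
    spine (withBrother κ w) = κ.1 ++ [κ.2 ++ [w]] := by
  rw [← spine_plugLast (κ.1 ++ [κ.2 ++ [w]]), plugLast_append]
  simp [withBrother, plugLast]

theorem lastBrother_withBrother (κ : List (List OTree) × List OTree) (w : OTree) :
    lastBrother (withBrother κ w) = w := by
  rw [lastBrother, spine_withBrother]; simp

theorem lastContext_withBrother (κ : List (List OTree) × List OTree) (w : OTree) :
    lastContext (withBrother κ w) = κ := by
  rw [lastContext, spine_withBrother]; simp

theorem work_withBrother (κ : List (List OTree) × List OTree) (w : OTree) :
    work (withBrother κ w) = work w + 1 :=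
  (work_plugLast_pair _ _ _).1

theorem size_withBrother (κ : List (List OTree) × List OTree) (w w' : OTree) :
    (withBrother κ w).size + w'.size = (withBrother κ w').size + w.size := by
  have h₁ := size_plugLast κ.1 (node (κ.2 ++ [w, node []]))
  have h₂ := size_plugLast κ.1 (node (κ.2 ++ [w', node []]))
  simp only [size, forestSize_append, forestSize] at h₁ h₂
  simp only [withBrother]
  omega

theorem size_lt_size_withBrother (κ : List (List OTree) × List OTree) (w : OTree) :
    w.size < (withBrother κ w).size := by
  have h₁ := size_plugLast κ.1 (node (κ.2 ++ [w, node []]))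
  have h₂ := size_pos (plugLast κ.1 (node []))
  simp only [size, forestSize_append, forestSize] at h₁
  simp only [withBrother]
  omega

theorem isT_withBrother {Δ : ℕ} {κ : List (List OTree) × List OTree} {w : OTree}
    (h : IsT Δ (withBrother κ w)) :
    IsT Δ w ∧ ∀ w', IsT Δ w' → IsT Δ (withBrother κ w') := by
  have h₁ := isT_node.1 (isT_of_plugLast h)
  refine ⟨h₁.2 w (by simp), fun w' hw' => isT_plugLast h (isT_node.2 ⟨?_, ?_⟩)⟩
  · simpa using h₁.1
  · intro t ht
    simp only [List.mem_append, List.mem_cons, List.not_mem_nil, or_false] at ht h₁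
    rcases ht with ht | rfl | rfl
    · exact h₁.2 t (.inl ht)
    · exact hw'
    · simp [isT_node]

/-- A tree with at least two nodes ends with an only child or with a last brother. -/
theorem eq_extend_or_withBrother {t : OTree} (ht : 2 ≤ t.size) :
    (∃ u, t = extend [] u) ∨ ∃ κ w, t = withBrother κ w := by
  rcases (spine t).eq_nil_or_concat with h | ⟨A, B, h⟩
  · rw [← plugLast_spine t, h] at ht
    simp [plugLast, size, forestSize] at ht
  · rw [List.concat_eq_append] at h
    rcases B.eq_nil_or_concat with rfl | ⟨us, w, rfl⟩
    · exact .inl ⟨plugLast A (node []), spine_injective (by rw [h, spine_extend, spine_plugLast])⟩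
    · refine .inr ⟨(A, us), w, spine_injective ?_⟩
      rw [h, spine_withBrother, List.concat_eq_append]

open Classical in
/-- The trees of a class whose last node has a left brother. -/
noncomputable def brotherClass (Δ n : ℕ) : Finset OTree :=
  (treeClass Δ n).filter fun t => ∃ κ w, t = withBrother κ w

theorem mem_brotherClass {Δ n : ℕ} {t : OTree} :
    t ∈ brotherClass Δ n ↔ t ∈ treeClass Δ n ∧ ∃ κ w, t = withBrother κ w := by
  simp [brotherClass]

open Classical in
-- Three disjoint kinds of trees: the last node is an only child; its only left brother is a leaf;
-- its nearest left brother is not a leaf. The second kind needs two children at a node, hence `2 ≤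
-- Δ`.
theorem card_add_card_le {Δ n : ℕ} (hΔ : 2 ≤ Δ) :
    (treeClass Δ (n + 1)).card + (treeClass Δ n).card +
      ((brotherClass Δ (n + 2)).filter fun t => lastBrother t ≠ node []).card ≤
        (treeClass Δ (n + 2)).card := by
  have hinj : ∀ us : List OTree, Function.Injective (extend us) := fun us t u h => by
    have := congrArg spine h
    rw [spine_extend, spine_extend] at this
    exact spine_injective (List.append_inj_left' this rfl)
  rw [← Finset.card_image_of_injective _ (hinj []),
    ← Finset.card_image_of_injective (treeClass Δ n) (hinj [node []]),
    ← Finset.card_union_of_disjoint, ← Finset.card_union_of_disjoint]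
  · refine Finset.card_le_card (Finset.union_subset (Finset.union_subset ?_ ?_) ?_)
    · rw [Finset.image_subset_iff]
      intro t ht
      simpa [forestSize] using extend_mem (us := []) ht (by simp; omega) (by simp)
    · rw [Finset.image_subset_iff]
      intro t ht
      simpa [forestSize, size] using
        extend_mem (us := [node []]) ht (by simp; omega) (by simp [isT_node])
    · exact (Finset.filter_subset _ _).trans (Finset.filter_subset _ _)
  · rw [Finset.disjoint_left]
    intro t ht ht'
    simp only [Finset.mem_union, Finset.mem_image, Finset.mem_filter, mem_brotherClass] at ht ht'
    obtain ⟨⟨-, κ, w, rfl⟩, hw⟩ := ht'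
    rw [lastBrother_withBrother] at hw
    rcases ht with ⟨u, -, hu⟩ | ⟨u, -, hu⟩ <;>
    · have := congrArg spine hu
      rw [spine_extend, spine_withBrother] at this
      have := List.append_inj_right' this rfl
      rcases κ with ⟨A, us⟩
      rcases us with _ | ⟨a, us⟩ <;> simp_all
  · rw [Finset.disjoint_left]
    intro t ht ht'
    simp only [Finset.mem_image] at ht ht'
    obtain ⟨u, -, rfl⟩ := ht
    obtain ⟨u', -, hu⟩ := ht'
    have := congrArg spine hu
    rw [spine_extend, spine_extend] at this
    have := List.append_inj_right' this rfl
    simp at this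

open Classical in
-- On each fibre of `lastContext` the brother ranges over a whole class of smaller trees, where the
-- hypothesis applies. Fibres with leaf brothers contribute `0`, so only the other trees are
-- charged; this gain makes the induction for the average close.
theorem sum_work_lastBrother_le {Δ n K : ℕ}
    (hK : ∀ m < n, ∑ t ∈ treeClass Δ m, work t ≤ K * (treeClass Δ m).card) :
    ∑ t ∈ brotherClass Δ n, work (lastBrother t) ≤
      K * ((brotherClass Δ n).filter fun t => lastBrother t ≠ node []).card := by
  have hmaps : ∀ t ∈ brotherClass Δ n, lastContext t ∈ (brotherClass Δ n).image lastContext :=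
    fun t ht => Finset.mem_image_of_mem _ ht
  rw [← Finset.sum_fiberwise_of_maps_to hmaps,
    Finset.card_eq_sum_card_fiberwise (f := lastContext) (t := (brotherClass Δ n).image lastContext)
      fun t ht => hmaps t (Finset.mem_filter.1 ht).1, Finset.mul_sum]
  refine Finset.sum_le_sum fun κ hκ => ?_
  obtain ⟨t, ht, rfl⟩ := Finset.mem_image.1 hκ
  rw [mem_brotherClass, mem_treeClass] at ht
  obtain ⟨⟨hT, hn⟩, κ, w, rfl⟩ := ht
  rw [lastContext_withBrother]
  -- The context and `n` fix the size of the brother, and nothing but that size and the degree bound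
  -- restricts it.
  have hfib : ((brotherClass Δ n).filter fun t => lastContext t = κ) =
      (treeClass Δ w.size).image (withBrother κ) := by
    ext u
    simp only [Finset.mem_filter, mem_brotherClass, Finset.mem_image, mem_treeClass]
    constructor
    · rintro ⟨⟨⟨h₁, h₂⟩, κ', w', rfl⟩, h⟩
      rw [lastContext_withBrother] at h
      subst h
      have := size_withBrother κ' w w'
      exact ⟨w', ⟨(isT_withBrother h₁).1, by omega⟩, rfl⟩
    · rintro ⟨w', ⟨h₁, h₂⟩, rfl⟩
      have := size_withBrother κ w w'
      exact ⟨⟨⟨(isT_withBrother hT).2 w' h₁, by omega⟩, κ, w', rfl⟩,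
        lastContext_withBrother κ w'⟩
  have hinj : Function.Injective (withBrother κ) := fun u v h => by
    rw [← lastBrother_withBrother κ u, h, lastBrother_withBrother]
  rw [Finset.filter_comm, hfib, Finset.sum_image hinj.injOn]
  simp only [lastBrother_withBrother]
  by_cases hw : w.size = 1
  · refine (Finset.sum_eq_zero fun u hu => ?_).trans_le (Nat.zero_le _)
    have := work_lt_size u
    rw [mem_treeClass] at hu
    omega
  · rw [Finset.filter_true_of_mem, Finset.card_image_of_injective _ hinj]
    · exact hK _ (by rw [← hn]; exact size_lt_size_withBrother κ w)
    · intro u hu h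
      obtain ⟨w', hw', rfl⟩ := Finset.mem_image.1 hu
      rw [lastBrother_withBrother] at h
      rw [mem_treeClass, h] at hw'
      simp [size, forestSize] at hw'
      omega

/-- Writing `W` for the sum, `B` for the trees whose last node has a left brother and `B'` for those
where it is not a leaf, the induction gives `W(n+3) ≤ 31 S(n+2) + 30 |B'| + |B|`. -/
theorem sum_work_le {Δ : ℕ} (hΔ : 2 ≤ Δ) (n : ℕ) :
    ∑ t ∈ treeClass Δ n, work t ≤ 30 * (treeClass Δ n).card := by
  classical
  induction n using Nat.strong_induction_on with
  | _ n ih =>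
    by_cases hn : n ≤ 2
    · rw [mul_comm, ← smul_eq_mul, ← Finset.sum_const]
      refine Finset.sum_le_sum fun t ht => ?_
      have := work_lt_size t
      rw [mem_treeClass] at ht
      omega
    obtain ⟨n, rfl⟩ : ∃ m, n = m + 3 := ⟨n - 3, by omega⟩
    have hsub : treeClass Δ (n + 3) ⊆
        (treeClass Δ (n + 2)).image (extend []) ∪ brotherClass Δ (n + 3) := by
      intro t ht
      have ht' := mem_treeClass.1 ht
      rw [Finset.mem_union, Finset.mem_image, mem_brotherClass]
      rcases eq_extend_or_withBrother (t := t) (by omega) with ⟨u, rfl⟩ | h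
      · refine .inl ⟨u, ?_, rfl⟩
        have := size_plugLast (spine u) (node ([] ++ [node []]))
        rw [plugLast_spine] at this
        simp only [size, forestSize_append, forestSize] at this
        rw [mem_treeClass]
        refine ⟨?_, ?_⟩
        · rw [← plugLast_spine u]
          exact isT_plugLast ht'.1 (by simp [isT_node])
        · rw [extend] at ht'
          omega
      · exact .inr ⟨ht, h⟩
    have h₁ : ∑ t ∈ (treeClass Δ (n + 2)).image (extend []), work t ≤
        31 * (treeClass Δ (n + 2)).card := by
      rw [Finset.sum_image]
      · simp only [work_extend_nil, Finset.sum_add_distrib, Finset.sum_const, smul_eq_mul]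
        have := ih (n + 2) (by omega)
        omega
      · intro t _ u _ h
        have := congrArg spine h
        rw [spine_extend, spine_extend] at this
        exact spine_injective (List.append_inj_left' this rfl)
    have h₂ : ∑ t ∈ brotherClass Δ (n + 3), work t =
        ∑ t ∈ brotherClass Δ (n + 3), work (lastBrother t) + (brotherClass Δ (n + 3)).card := by
      rw [Finset.card_eq_sum_ones, ← Finset.sum_add_distrib]
      refine Finset.sum_congr rfl fun t ht => ?_
      obtain ⟨-, κ, w, rfl⟩ := mem_brotherClass.1 ht
      rw [work_withBrother, lastBrother_withBrother]
    have h₃ := sum_work_lastBrother_le (Δ := Δ) ih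
    have h₄ : (treeClass Δ (n + 2)).card + (treeClass Δ (n + 1)).card +
        ((brotherClass Δ (n + 3)).filter fun t => lastBrother t ≠ node []).card ≤
          (treeClass Δ (n + 3)).card := card_add_card_le hΔ
    have h₅ : (treeClass Δ (n + 3)).card ≤ 5 * (treeClass Δ (n + 2)).card :=
      card_treeClass_succ_le Δ (n + 2) (by omega)
    have h₆ : (treeClass Δ (n + 2)).card ≤ 5 * (treeClass Δ (n + 1)).card :=
      card_treeClass_succ_le Δ (n + 1) (by omega)
    have h₇ : (brotherClass Δ (n + 3)).card ≤ (treeClass Δ (n + 3)).card :=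
      Finset.card_le_card (Finset.filter_subset _ _)
    have h₈ := Finset.sum_le_sum_of_subset (f := work) hsub
    have h₉ := Finset.sum_union_inter (s₁ := (treeClass Δ (n + 2)).image (extend []))
      (s₂ := brotherClass Δ (n + 3)) (f := work)
    -- By `h₄`, `30 (S(n+2) + |B'|)` is at most `30 S(n+3) - 30 S(n+1)`. The remaining `S(n+2) +
    -- |B|` is at most `(5 + 25) S(n+1)`, and this fixes the constant `30`.
    omega

theorem treeClass_nonempty {Δ n : ℕ} (hΔ : 1 ≤ Δ) (hn : 1 ≤ n) : (treeClass Δ n).Nonempty :=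
  ⟨chain (n - 1), mem_treeClass.2 ⟨isT_chain hΔ _, by rw [size_chain]; omega⟩⟩

end OTree

-- The theorem

theorem mainTheorem2 :
    ∃ K : ℕ,
      -- every call is correct and takes at most `K * n` steps
      (∀ Δ n : ℕ, ∀ t ∈ OTree.treeClass Δ n, ∀ σ : Memory, AOrder.Holds Δ n t σ →
        ∃ (k : ℕ) (σ' : Memory), Exec AOrder.next σ k σ' ∧ k ≤ K * n ∧
          (∀ t', OTree.IsNext Δ n t t' →
            σ'.flag BoolVar.noSuccessor = false ∧ AOrder.Holds Δ n t' σ') ∧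
          ((∀ u ∈ OTree.treeClass Δ n, ¬ OTree.ALt t u) →
            σ'.flag BoolVar.noSuccessor = true ∧ AOrder.Holds Δ n t σ')) ∧
      -- the average of the running times over `T_n^Δ` is at most `K`
      (∀ Δ n : ℕ, 2 ≤ Δ → 1 ≤ n → ∀ (start : OTree → Memory) (time : OTree → ℕ),
        (∀ t ∈ OTree.treeClass Δ n, AOrder.Holds Δ n t (start t)) →
        (∀ t ∈ OTree.treeClass Δ n, ∃ σ' : Memory, Exec AOrder.next (start t) (time t) σ') →
        (∑ t ∈ OTree.treeClass Δ n, (time t : ℝ)) / ((OTree.treeClass Δ n).card : ℝ) ≤ K) ∧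
      -- `S^{n+1,Δ} / S^{n,Δ} = O(1)`
      (∀ Δ n : ℕ, 1 ≤ Δ → 1 ≤ n →
        ((OTree.treeClass Δ (n + 1)).card : ℝ) / ((OTree.treeClass Δ n).card : ℝ) ≤ K) := by
  -- `15060 = 500 * 30 + 60`: the time in terms of `work`, with the average of `work` at most `30`.
  -- The other two claims need only `560` and `5`.
  refine ⟨15060, ?_, ?_, ?_⟩
  · intro Δ n t ht σ hσ
    obtain ⟨k, σ', h, hk, h₁, h₂⟩ := AOrder.exec_next_correct ht hσ
    exact ⟨k, σ', h, by omega, h₁, h₂⟩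
  · intro Δ n hΔ hn start time hstart htime
    have hcard := (OTree.treeClass_nonempty (by omega : 1 ≤ Δ) hn).card_pos
    have hsum : ∑ t ∈ OTree.treeClass Δ n, time t ≤ 15060 * (OTree.treeClass Δ n).card := by
      have h₁ : ∑ t ∈ OTree.treeClass Δ n, time t ≤
          ∑ t ∈ OTree.treeClass Δ n, (500 * OTree.work t + 60) :=
        Finset.sum_le_sum fun t ht =>
          let ⟨_, h⟩ := htime t ht
          AOrder.exec_next_le ht (hstart t ht) h
      have h₂ := OTree.sum_work_le hΔ n
      rw [Finset.sum_add_distrib, ← Finset.mul_sum, Finset.sum_const, smul_eq_mul] at h₁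
      omega
    rw [div_le_iff₀ (by exact_mod_cast hcard)]
    exact_mod_cast hsum
  · intro Δ n hΔ hn
    have hcard := (OTree.treeClass_nonempty hΔ hn).card_pos
    have h := OTree.card_treeClass_succ_le Δ n hn
    rw [div_le_iff₀ (by exact_mod_cast hcard)]
    exact_mod_cast h.trans (Nat.mul_le_mul_right _ (by norm_num))
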